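/- **Theorem (Interpolation in time).** Setting. Let $d\ge 1$, let $\Omega\subset\mathbb{R}^d$ be a bounded open set, and let $J=(0,T)$ with $0<T<\infty$. For open $\omega\subset\Omega$ let $W^{1,2}_0(\omega)$ be the closure of $C_c^\infty(\omega)$ in $W^{1,2}(\omega)$, normed by $\|\nabla\cdot\|_{L^2(\omega)}$, and let $W^{-1,2}(\omega)=W^{1,2}_0(\omega)^*$ be its dual space with the dual norm; a function $u\in L^2(\Omega)$ is identified with the functional $g\mapsto\int_\omega u\,g\,dx$. Let $$V=L^2(J;W^{1,2}_0(\Omega))\cap W^{1,2}(J;W^{-1,2}(\Omega)).$$ Partition in time. Let $\mathcal{T}_t$ be a partition $0=t_0<t_1<\dots<t_N=T$ of $[0,T]$ into closed intervals $[t_{n},t_{n+1}]$. For $K_t\in\mathcal{T}_t$ let $h_{K_t}=|K_t|$ and let $\omega_{K_t}=\bigcup\{K_t'\in\mathcal{T}_t: K_t\cap K_t'\ne\emptyset\}$. Assume that $\mathcal{T}_t$ is shape regular with constant $\kappa$, that is, $|\omega_{K_t}|\le\kappa\,h_{K_t}$ for all $K_t\in\mathcal{T}_t$. The projection. Let $k_t\ge1$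 be an integer. On the reference interval $[0,1]$ let $b_j(x)=\binom{k_t}{j}x^j(1-x)^{k_t-j}$, $0\le j\le k_t$, be the Bernstein polynomials, and let $p_j$, $0\le j\le k_t$, be the (unique) polynomials of the form $$p_j=b_j\Big((k_t+1)+q_j-\sum_{\mu=0}^{k_t}b_\mu q_\mu\Big)$$ with polynomials $q_0,\dots,q_{k_t}$ of degree at most $k_t$ that satisfy $\int_0^1p_i\,b_j\,dx=\delta_{ij}$ for all $0\le i,j\le k_t$. Let $\mathcal{N}_t$ be the set of the $Nk_t+1$ Lagrange nodes of order $k_t$ of $\mathcal{T}_t$. For $i\in\mathcal{N}_t$ let $\omega_i$ be the union of the intervals in $\mathcal{T}_t$ that contain $i$. Let $b_{t,i}$ (respectively $\psi_{t,i}$) be the function that vanishes outside $\omega_i$ and that equals, on each interval of $\omega_i$, the polynomial $b_j$ (respectively $|\omega_i|^{-1}p_j$), transported from $[0,1]$ by the increasing affine map, where $j$ is the number of the node $i$ in this interval (counted from $0$, from left to right). The projection $\Pi_t$ is $$\Pi_tv=\sum_{i\in\mathcal{N}_t}\Big(\int_J v(\sigma)\,\psi_{t,i}(\sigma)\,d\sigma\Big)\,b_{t,i}\qquad\text{for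 }v\in L^2(J;L^2(\Omega)).$$ Claim. There is a constant $C$ that depends only on $k_t$ and $\kappa$ such that the following holds. Let $X=W^{-1,2}(\omega)$ with $\omega\subset\Omega$ open, or $X=L^2(K_x)$ with a simplex $K_x$ of a regular (conforming) partition $\mathcal{T}_x$ of $\overline\Omega$ into finitely many closed simplices. Then for all $v\in V$, all integers $0\le m\le s\le k_t+1$, and all $K_t\in\mathcal{T}_t$, $$\|\partial_t^m(v-\Pi_tv)\|_{L^2(K_t;X)}\le C\,h_{K_t}^{s-m}\,\|\partial_t^sv\|_{L^2(\omega_{K_t};X)} .$$ Here $\partial_t^m$ denotes the weak derivative in the interior of the respective interval, and a norm has the value $\infty$ if the weak derivative does not exist or is not in the respective space; in the case $X=L^2(K_x)$ functions on $\Omega$ are restricted to $K_x\cap\Omega$. -/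

import Mathlib

open MeasureTheory Set
open scoped NNReal ENNReal Polynomial

namespace SpaceTime

/-! ### Reference weights -/

/-- The `L²(0,1)` product of two polynomials on the reference interval. -/
noncomputable def ip (f g : ℝ[X]) : ℝ := ∫ x in (0 : ℝ)..1, f.eval x * g.eval x

/-- The family `p 0, …, p k` of weights on the reference interval: `p j = b j * z j` with
`z j = (k+1) + q j - ∑ μ, b μ * q μ` for some polynomials `q j` of degree at most `k`, where
`b j = bernsteinPolynomial ℝ k j`, and biorthogonal to the Bernstein basis. (The `z j` are uniquely
determined by these conditions.) -/
def IsLocalDual (k : ℕ) (p : ℕ → ℝ[X]) : Prop :=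
  (∃ q : ℕ → ℝ[X], (∀ j ≤ k, (q j).natDegree ≤ k) ∧
    ∀ j ≤ k, p j = bernsteinPolynomial ℝ k j * ((k + 1 : ℝ[X]) + q j
      - ∑ μ ∈ Finset.range (k + 1), bernsteinPolynomial ℝ k μ * q μ)) ∧
  ∀ i ≤ k, ∀ j ≤ k, ip (p i) (bernsteinPolynomial ℝ k j) = if i = j then 1 else 0

lemma ip_intervalIntegrable (f : ℝ[X]) : IntervalIntegrable (fun x => f.eval x) volume (0:ℝ) 1 :=
  f.continuous.intervalIntegrable _ _

lemma ip_eq (f g : ℝ[X]) : ip f g = ∫ x in (0 : ℝ)..1, (f * g).eval x := by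
  simp [ip]

lemma ip_add_left (f g h : ℝ[X]) : ip (f + g) h = ip f h + ip g h := by
  rw [ip_eq, ip_eq, ip_eq, ← intervalIntegral.integral_add (ip_intervalIntegrable _)
    (ip_intervalIntegrable _)]
  simp [add_mul]

lemma ip_smul_left (c : ℝ) (f h : ℝ[X]) : ip (c • f) h = c * ip f h := by
  rw [ip_eq, ip_eq, ← intervalIntegral.integral_const_mul]
  simp

lemma ip_comm (f g : ℝ[X]) : ip f g = ip g f := by
  rw [ip_eq, ip_eq, mul_comm]

/-- `ip` as a bilinear map. -/
noncomputable def ipL : ℝ[X] →ₗ[ℝ] ℝ[X] →ₗ[ℝ] ℝ :=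
  LinearMap.mk₂ ℝ ip ip_add_left (fun c f h => by simpa using ip_smul_left c f h)
    (fun f g h => by rw [ip_comm, ip_add_left, ip_comm g, ip_comm h])
    (fun c f h => by rw [ip_comm, ip_smul_left, ip_comm h]; rfl)

lemma ipL_apply (f g : ℝ[X]) : ipL f g = ip f g := rfl

lemma bernstein_integral (k : ℕ) (j : ℕ) (hj : j ≤ k) :
    ip (bernsteinPolynomial ℝ k j) 1 = 1 / (k + 1) := by
  have step : ∀ ν, ν < k → ip (bernsteinPolynomial ℝ k ν) 1
      = ip (bernsteinPolynomial ℝ k (ν + 1)) 1 := by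
    intro ν hν
    have h := intervalIntegral.integral_eq_sub_of_hasDerivAt (a := (0:ℝ)) (b := 1)
      (f := fun x => (bernsteinPolynomial ℝ (k + 1) (ν + 1)).eval x)
      (fun x _ => (bernsteinPolynomial ℝ (k + 1) (ν + 1)).hasDerivAt x)
      (ip_intervalIntegrable _)
    rw [bernsteinPolynomial.eval_at_0, bernsteinPolynomial.eval_at_1,
      bernsteinPolynomial.derivative_succ, if_neg (by omega), if_neg (by omega)] at h
    have h2 : ip (((k + 1 : ℕ) : ℝ) • (bernsteinPolynomial ℝ k ν
        + (-1 : ℝ) • bernsteinPolynomial ℝ k (ν + 1))) 1 = 0 := by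
      rw [ip_eq]
      refine Eq.trans ?_ (h.trans (sub_zero 0))
      congr 1
      ext x
      simp [Polynomial.smul_eq_C_mul]
      ring
    rw [ip_smul_left, ip_add_left, ip_smul_left] at h2
    have : ((k + 1 : ℕ) : ℝ) ≠ 0 := by positivity
    have := (mul_eq_zero.1 h2).resolve_left this
    linarith
  have all : ∀ ν ≤ k, ip (bernsteinPolynomial ℝ k ν) 1 = ip (bernsteinPolynomial ℝ k 0) 1 := by
    intro ν
    induction ν with
    | zero => intro _; rfl
    | succ n ih => intro h; rw [← step n (by omega), ih (by omega)]
  have hs : ∑ ν ∈ Finset.range (k + 1), ip (bernsteinPolynomial ℝ k ν) 1 = 1 := by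
    have : ∑ ν ∈ Finset.range (k + 1), ipL.flip 1 (bernsteinPolynomial ℝ k ν) = 1 := by
      rw [← map_sum, bernsteinPolynomial.sum]
      simp [ipL_apply, ip]
    exact this
  rw [Finset.sum_congr rfl (fun ν hν => all ν (by simpa [Nat.lt_succ_iff] using hν))] at hs
  rw [all j hj]
  simp at hs
  field_simp
  linarith

lemma bernstein_indep (k : ℕ) (c : Fin (k + 1) → ℝ)
    (h : ∑ j : Fin (k + 1), c j • bernsteinPolynomial ℝ k j = 0) : c = 0 := by
  let P : ℝ[X] := ∑ j : Fin (k + 1), Polynomial.C (c j * (k.choose j : ℝ)) * Polynomial.X ^ (j : ℕ)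
  have hP : P = 0 := by
    refine Polynomial.eq_zero_of_infinite_isRoot P (Set.Infinite.mono ?_ (Set.Ioi_infinite (0:ℝ)))
    intro y hy
    have hy : 0 < y := hy
    have hy1 : (1 + y) ≠ 0 := by positivity
    have h1 := congrArg (Polynomial.eval (y / (1 + y))) h
    simp only [Polynomial.eval_finsetSum, Polynomial.eval_smul, bernsteinPolynomial,
      Polynomial.eval_mul, Polynomial.eval_pow, Polynomial.eval_X, Polynomial.eval_natCast,
      Polynomial.eval_sub, Polynomial.eval_one, smul_eq_mul, Polynomial.eval_zero] at h1
    have h2 : P.eval y = (1 + y) ^ k * 0 := by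
      rw [← h1, Finset.mul_sum]
      simp only [P, Polynomial.eval_finsetSum, Polynomial.eval_mul, Polynomial.eval_pow,
        Polynomial.eval_X, Polynomial.eval_C]
      refine Finset.sum_congr rfl fun j _ => ?_
      have e : 1 - y / (1 + y) = 1 / (1 + y) := by field_simp; ring
      have e2 : (1 + y) ^ k = (1 + y) ^ (j : ℕ) * (1 + y) ^ (k - j) := by
        rw [← pow_add]; congr 1; omega
      rw [e, e2, div_pow, div_pow]
      field_simp
      simp
    simpa [Polynomial.IsRoot] using h2
  ext j
  have h3 := congrArg (fun p => Polynomial.coeff p (j : ℕ)) hP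
  simp only [P, Polynomial.finsetSum_coeff, Polynomial.coeff_C_mul, Polynomial.coeff_X_pow,
    Polynomial.coeff_zero] at h3
  rw [Finset.sum_eq_single j (fun b _ hb => by
    rw [if_neg (fun h => hb (Fin.ext h.symm))]; simp) (by simp)] at h3
  have : (k.choose j : ℝ) ≠ 0 := by
    exact_mod_cast (Nat.choose_pos (by omega)).ne'
  simpa [this] using h3

set_option maxHeartbeats 800000 in
lemma exists_localDual (k : ℕ) : ∃ p, IsLocalDual k p := by
  let b : Fin (k + 1) → ℝ[X] := fun j => bernsteinPolynomial ℝ k j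
  have hb1 : ∑ j, b j = 1 := by
    rw [← bernsteinPolynomial.sum ℝ k, Finset.sum_range]
  let Q : Fin (k + 1) → (Fin (k + 1) → Fin (k + 1) → ℝ) →ₗ[ℝ] ℝ[X] := fun a =>
    ∑ c, ((LinearMap.proj c : (Fin (k + 1) → ℝ) →ₗ[ℝ] ℝ) ∘ₗ LinearMap.proj a).smulRight (b c)
  have hQ : ∀ a ρ, Q a ρ = ∑ c, ρ a c • b c := by intro a ρ; simp [Q]
  let D : Fin (k + 1) → (Fin (k + 1) → Fin (k + 1) → ℝ) →ₗ[ℝ] ℝ[X] := fun a =>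
    Q a - ∑ μ, LinearMap.mulLeft ℝ (b μ) ∘ₗ Q μ
  have hD : ∀ a ρ, D a ρ = Q a ρ - ∑ μ, b μ * Q μ ρ := by intro a ρ; simp [D]
  have hD0 : ∀ ρ, ∑ a, b a * D a ρ = 0 := by
    intro ρ
    simp only [hD, mul_sub, Finset.sum_sub_distrib]
    rw [← Finset.sum_mul, hb1, one_mul, sub_self]
  let B : (Fin (k + 1) → Fin (k + 1) → ℝ) →ₗ[ℝ] (Fin (k + 1) → Fin (k + 1) → ℝ) →ₗ[ℝ] ℝ :=
    ∑ a, ipL.compl₁₂ (LinearMap.mulLeft ℝ (b a) ∘ₗ D a) (Q a)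
  have hB : ∀ ρ σ, B ρ σ = ∑ a, ip (b a * D a ρ) (Q a σ) := by
    intro ρ σ; simp [B, ipL_apply]
  clear_value B D Q
  have hBD : ∀ ρ σ, B ρ σ = ∑ a, ip (b a * D a ρ) (D a σ) := by
    intro ρ σ
    rw [hB]
    simp only [hD _ σ, ← ipL_apply, map_sub, Finset.sum_sub_distrib]
    rw [← LinearMap.sum_apply, ← map_sum, hD0]
    simp
  have hsymm : ∀ ρ σ, B ρ σ = B σ ρ := by
    intro ρ σ
    rw [hBD, hBD]
    refine Finset.sum_congr rfl fun a _ => ?_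
    rw [ip_eq, ip_eq, mul_right_comm]
  -- the kernel consists of the constant families
  have hker : ∀ ρ, B ρ = 0 → ∀ a a', ρ a = ρ a' := by
    intro ρ hρ
    have h0 : ∑ a, ip (b a * D a ρ) (D a ρ) = 0 := by rw [← hBD, hρ]; rfl
    have bpos : ∀ a, ∀ x ∈ Ioo (0:ℝ) 1, 0 < (b a).eval x := by
      intro a x hx
      simp only [b, bernsteinPolynomial, Polynomial.eval_mul, Polynomial.eval_pow,
        Polynomial.eval_X, Polynomial.eval_natCast, Polynomial.eval_sub, Polynomial.eval_one]
      have h1 : 0 < 1 - x := by linarith [hx.2]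
      have h2 : (0:ℝ) < (k.choose a : ℝ) := by
        exact_mod_cast Nat.choose_pos (by omega)
      have h3 := hx.1
      positivity
    have nn : ∀ a, ∀ x ∈ Ioo (0:ℝ) 1, 0 ≤ (b a * D a ρ * D a ρ).eval x := by
      intro a x hx
      simp only [Polynomial.eval_mul]
      have := (bpos a x hx).le
      rw [mul_assoc]
      exact mul_nonneg this (mul_self_nonneg _)
    have ipnn : ∀ a, 0 ≤ ip (b a * D a ρ) (D a ρ) := by
      intro a
      rw [ip_eq, intervalIntegral.integral_of_le zero_le_one, integral_Ioc_eq_integral_Ioo]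
      exact setIntegral_nonneg measurableSet_Ioo (nn a)
    have hD' : ∀ a, D a ρ = 0 := by
      intro a
      have h1 := (Finset.sum_eq_zero_iff_of_nonneg (fun a _ => ipnn a)).1 h0 a (Finset.mem_univ a)
      by_contra hne
      have hroot : ((D a ρ).rootSet ℝ).Finite := Polynomial.rootSet_finite _ _
      have hinf : (Ioo (0:ℝ) 1).Infinite := Set.Ioo_infinite zero_lt_one
      obtain ⟨x, hx, hxr⟩ := (hinf.sdiff hroot).nonempty
      have hx0 : (D a ρ).eval x ≠ 0 := by
        intro h; apply hxr; rw [Polynomial.mem_rootSet]; exact ⟨hne, by simpa using h⟩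
      have hpos : 0 < ip (b a * D a ρ) (D a ρ) := by
        rw [ip_eq]
        refine intervalIntegral.integral_pos zero_lt_one (Polynomial.continuous _).continuousOn
          ?_ ⟨x, ⟨hx.1.le, hx.2.le⟩, ?_⟩
        · intro y hy
          rcases eq_or_lt_of_le hy.2 with rfl | hy2
          · simp only [Polynomial.eval_mul, mul_assoc]
            refine mul_nonneg ?_ (mul_self_nonneg _)
            simp only [b, bernsteinPolynomial.eval_at_1]; split_ifs <;> norm_num
          · exact nn a y ⟨hy.1, hy2⟩
        · simp only [Polynomial.eval_mul, mul_assoc]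
          exact mul_pos (bpos a x hx) (mul_self_pos.2 hx0)
      exact hpos.ne' h1
    intro a a'
    have : Q a ρ = Q a' ρ := by
      have h1 := hD' a; have h2 := hD' a'
      rw [hD] at h1 h2
      exact (sub_eq_zero.1 h1).trans (sub_eq_zero.1 h2).symm
    rw [hQ, hQ, ← sub_eq_zero, ← Finset.sum_sub_distrib] at this
    have := bernstein_indep k (ρ a - ρ a') (by simpa [sub_smul] using this)
    exact sub_eq_zero.1 this
  let ℓ : (Fin (k + 1) → Fin (k + 1) → ℝ) →ₗ[ℝ] ℝ :=
    ∑ a, ((LinearMap.proj a : (Fin (k + 1) → ℝ) →ₗ[ℝ] ℝ) ∘ₗ LinearMap.proj a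
      - ((k : ℝ) + 1) • (ipL (b a) ∘ₗ Q a))
  have hℓ : ∀ σ, ℓ σ = ∑ a, (σ a a - (k + 1) * ip (b a) (Q a σ)) := by
    intro σ; simp [ℓ, ipL_apply]
  clear_value ℓ
  have hmem : ℓ ∈ LinearMap.range B.dualMap := by
    rw [LinearMap.range_dualMap_eq_dualAnnihilator_ker, Submodule.mem_dualAnnihilator]
    intro σ hσ
    have hc := hker σ (LinearMap.mem_ker.1 hσ)
    have hQc : ∀ a, Q a σ = Q 0 σ := fun a => by rw [hQ, hQ, hc a 0]
    rw [hℓ, Finset.sum_sub_distrib, ← Finset.mul_sum]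
    simp only [hQc, hc _ 0]
    have h1 : ∑ a, ip (b a) (Q 0 σ) = ip (Q 0 σ) 1 := by
      simp only [← ipL_apply]
      rw [← LinearMap.sum_apply, ← map_sum, hb1, ipL_apply, ip_comm, ipL_apply]
    have h2 : ip (Q 0 σ) 1 = ∑ c, σ 0 c * (1 / (k + 1)) := by
      rw [hQ, ← ipL_apply, map_sum, LinearMap.sum_apply]
      refine Finset.sum_congr rfl fun c _ => ?_
      rw [ipL_apply, ip_smul_left, bernstein_integral k c (by omega)]
    rw [h1, h2, ← Finset.sum_mul]
    field_simp
    simp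
  obtain ⟨F, hF⟩ := hmem
  obtain ⟨ρ, rfl⟩ := (Module.evalEquiv ℝ (Fin (k + 1) → Fin (k + 1) → ℝ)).surjective F
  have hρ : ∀ σ, B ρ σ = ℓ σ := by
    intro σ
    rw [← hF, hsymm]; rfl
  have key : ∀ a c, ip (b a * D a ρ) (b c) = (if a = c then 1 else 0) - (k + 1) * ip (b a) (b c) := by
    intro a c
    have h := hρ (Pi.single a (Pi.single c 1))
    have hQs : ∀ a', Q a' (Pi.single a (Pi.single c 1)) = if a' = a then b c else 0 := by
      intro a'
      rw [hQ]
      split_ifs with h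
      · subst h; simp [Pi.single_apply]
      · simp [h]
    have ip0 : ∀ f, ip f 0 = 0 := fun f => by simp [ip]
    rw [hB, hℓ, Finset.sum_sub_distrib, ← Finset.mul_sum] at h
    simp only [hQs, apply_ite (ip _), ip0, Finset.sum_ite_eq', Finset.mem_univ, if_true] at h
    rw [h]
    congr 1
    rw [Finset.sum_eq_single a (fun a' _ h' => by simp [h']) (by simp)]
    simp [Pi.single_apply]
  let q : ℕ → ℝ[X] := fun j => if h : j < k + 1 then Q ⟨j, h⟩ ρ else 0
  have hqsum : ∑ μ ∈ Finset.range (k + 1), bernsteinPolynomial ℝ k μ * q μ = ∑ μ, b μ * Q μ ρ := by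
    rw [Finset.sum_range]
    refine Finset.sum_congr rfl fun μ _ => ?_
    simp only [q, b, dif_pos μ.2]
  refine ⟨fun j => bernsteinPolynomial ℝ k j * ((k + 1 : ℝ[X]) + q j
      - ∑ μ ∈ Finset.range (k + 1), bernsteinPolynomial ℝ k μ * q μ), ⟨q, ?_, fun _ _ => rfl⟩, ?_⟩
  · intro j hj
    simp only [q, dif_pos (Nat.lt_succ_of_le hj), hQ]
    refine Polynomial.natDegree_sum_le_of_forall_le _ _ fun c _ => ?_
    refine (Polynomial.natDegree_smul_le _ _).trans ?_
    simp only [b, bernsteinPolynomial]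
    have hc : (c : ℕ) ≤ k := by omega
    calc _ ≤ 0 + (c : ℕ) + (k - c) := by
          refine Polynomial.natDegree_mul_le_of_le (Polynomial.natDegree_mul_le_of_le
            (by simp) (by simp)) ?_
          refine (Polynomial.natDegree_pow_le_of_le (m := 1) _ ?_).trans (by simp)
          exact (Polynomial.natDegree_sub_le _ _).trans (by simp)
      _ ≤ k := by omega
  · intro i hi j hj
    have h := key ⟨i, Nat.lt_succ_of_le hi⟩ ⟨j, Nat.lt_succ_of_le hj⟩
    rw [hD] at h
    simp only [hqsum, q, dif_pos (Nat.lt_succ_of_le hi)]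
    have e : bernsteinPolynomial ℝ k i * ((k + 1 : ℝ[X]) + Q ⟨i, Nat.lt_succ_of_le hi⟩ ρ
        - ∑ μ, b μ * Q μ ρ) = ((k : ℝ) + 1) • bernsteinPolynomial ℝ k i
        + bernsteinPolynomial ℝ k i * (Q ⟨i, Nat.lt_succ_of_le hi⟩ ρ - ∑ μ, b μ * Q μ ρ) := by
      rw [Polynomial.smul_eq_C_mul]
      simp
      ring
    rw [e, ip_add_left, ip_smul_left]
    simp only [b, Fin.mk.injEq] at h
    simp only [b]
    rw [h]
    ring

/-! ### Function spaces in space -/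

/-- `ℝ^d` with the Euclidean norm. -/
abbrev Euc (d : ℕ) := EuclideanSpace ℝ (Fin d)

/-- `L²(Ω)` for a subset `Ω` of `ℝ^d`. -/
noncomputable abbrev L2 {d : ℕ} (Ω : Set (Euc d)) := Lp ℝ 2 (volume.restrict Ω)

/-- Restriction `L²(Ω) → L²(S)` for `S ⊆ Ω`. -/
noncomputable def restrictL2 {d : ℕ} {S Ω : Set (Euc d)} (h : S ⊆ Ω) (u : L2 Ω) : L2 S :=
  ((Lp.memLp u).mono_measure (Measure.restrict_mono h le_rfl)).toLp u

/-- The pairs `(φ, ∇φ)`, as elements of `L²(ω) × L²(ω; ℝ^d)`, of test functions `φ ∈ C_c^∞(ω)`. -/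
noncomputable def testGraph {d : ℕ} (ω : Set (Euc d)) :
    Submodule ℝ (L2 ω × Lp (Euc d) 2 (volume.restrict ω)) where
  carrier := {p | ∃ φ : Euc d → ℝ, ContDiff ℝ (⊤ : ℕ∞) φ ∧ HasCompactSupport φ ∧ tsupport φ ⊆ ω ∧
    p.1 =ᵐ[volume.restrict ω] φ ∧ p.2 =ᵐ[volume.restrict ω] gradient φ}
  zero_mem' := by
    refine ⟨0, contDiff_const, HasCompactSupport.zero, by simp [tsupport], Lp.coeFn_zero _ _ _, ?_⟩
    filter_upwards [Lp.coeFn_zero (Euc d) 2 (volume.restrict ω)] with x hx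
    simp only [Prod.snd_zero, hx, Pi.zero_apply]
    exact (gradient_const x 0).symm
  add_mem' := by
    rintro p q ⟨φ, h1, h2, h3, h4, h5⟩ ⟨χ, k1, k2, k3, k4, k5⟩
    refine ⟨φ + χ, h1.add k1, h2.add k2,
      (tsupport_add _ _).trans (union_subset h3 k3), ?_, ?_⟩
    · exact (Lp.coeFn_add _ _).trans (h4.add k4)
    · refine (Lp.coeFn_add _ _).trans ((h5.add k5).trans (Filter.Eventually.of_forall fun x => ?_))
      have hφ : DifferentiableAt ℝ φ x := (h1.differentiable (by simp)) x
      have hχ : DifferentiableAt ℝ χ x := (k1.differentiable (by simp)) x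
      simp [gradient, fderiv_add hφ hχ]
  smul_mem' := by
    rintro c p ⟨φ, h1, h2, h3, h4, h5⟩
    refine ⟨c • φ, h1.const_smul c, h2.smul_left (f := fun _ => c), 
      (closure_mono (Function.support_const_smul_subset c φ)).trans h3, ?_, ?_⟩
    · exact (Lp.coeFn_smul _ _).trans (h4.const_smul c)
    · refine (Lp.coeFn_smul _ _).trans ((h5.const_smul c).trans
        (Filter.Eventually.of_forall fun x => ?_))
      have hφ : DifferentiableAt ℝ φ x := (h1.differentiable (by simp)) x
      simp [gradient, fderiv_const_smul hφ]

/-- The Sobolev space `W_0^{1,2}(ω)`: the closure of the test functions with respect to the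
`W^{1,2}` norm; an element is represented by the pair `(u, ∇u)`. -/
def W01 {d : ℕ} (ω : Set (Euc d)) : Type := ↥(testGraph ω).topologicalClosure

namespace W01

variable {d : ℕ} {ω : Set (Euc d)}

noncomputable instance : AddCommGroup (W01 ω) :=
  inferInstanceAs (AddCommGroup ↥(testGraph ω).topologicalClosure)

noncomputable instance : Module ℝ (W01 ω) :=
  inferInstanceAs (Module ℝ ↥(testGraph ω).topologicalClosure)

/-- The underlying `L²` function. -/
noncomputable def toL2 : W01 ω →ₗ[ℝ] L2 ω :=
  LinearMap.fst ℝ _ _ ∘ₗ (testGraph ω).topologicalClosure.subtype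

/-- The weak gradient. -/
noncomputable def grad : W01 ω →ₗ[ℝ] Lp (Euc d) 2 (volume.restrict ω) :=
  LinearMap.snd ℝ _ _ ∘ₗ (testGraph ω).topologicalClosure.subtype

/-- `W_0^{1,2}(ω)` carries the norm `‖∇u‖_{L²(ω)}`. -/
noncomputable instance : SeminormedAddCommGroup (W01 ω) :=
  SeminormedAddCommGroup.induced (W01 ω) (Lp (Euc d) 2 (volume.restrict ω)) grad

noncomputable instance : NormedSpace ℝ (W01 ω) :=
  NormedSpace.induced ℝ (W01 ω) (Lp (Euc d) 2 (volume.restrict ω)) grad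

lemma norm_def (u : W01 ω) : ‖u‖ = ‖grad u‖ := rfl

end W01

/-- Friedrichs' inequality for test functions. -/
lemma friedrichs_test {d : ℕ} [NeZero d] {ω : Set (Euc d)} {R : ℝ} (hR : ∀ x ∈ ω, ‖x‖ ≤ R)
    (p : L2 ω × Lp (Euc d) 2 (volume.restrict ω)) (hp : p ∈ testGraph ω) :
    ‖p.1‖ ≤ 2 * R * ‖p.2‖ := by
  obtain ⟨φ, h1, h2, h3, h4, h5⟩ := hp
  rcases eq_or_ne ‖p.1‖ 0 with h0 | h0
  · rw [h0]
    rcases ω.eq_empty_or_nonempty with rfl | ⟨x, hx⟩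
    · have : ‖p.2‖ = 0 := by
        rw [Lp.norm_def]; simp
      rw [this]; simp
    · have := (norm_nonneg x).trans (hR x hx)
      positivity
  have hne : ω.Nonempty := by
    by_contra h
    rw [not_nonempty_iff_eq_empty] at h
    subst h
    apply h0
    rw [Lp.norm_def]; simp
  have hR0 : 0 ≤ R := by
    obtain ⟨x, hx⟩ := hne
    exact (norm_nonneg x).trans (hR x hx)
  let e : Euc d := EuclideanSpace.single 0 1
  let g : Euc d → ℝ := fun x => x 0
  have hg : ∀ x, HasFDerivAt g (EuclideanSpace.proj 0 : Euc d →L[ℝ] ℝ) x := fun x =>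
    (EuclideanSpace.proj (0 : Fin d) : Euc d →L[ℝ] ℝ).hasFDerivAt
  have hgc : Continuous g := (EuclideanSpace.proj (0 : Fin d) : Euc d →L[ℝ] ℝ).continuous
  have hge : ∀ x, fderiv ℝ g x e = 1 := fun x => by rw [(hg x).fderiv]; simp [e]
  have hφd : Differentiable ℝ φ := h1.differentiable (by simp)
  have hφ2 : ∀ x, fderiv ℝ (fun x => φ x * φ x) x e = 2 * φ x * fderiv ℝ φ x e := by
    intro x
    rw [fderiv_fun_mul (hφd x) (hφd x)]
    simp; ring
  have hdc : Continuous fun x => fderiv ℝ φ x e :=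
    (h1.continuous_fderiv (by simp)).clm_apply continuous_const
  have hφc : Continuous φ := h1.continuous
  have cs : ∀ f : Euc d → ℝ, Continuous f → Integrable (fun x => φ x * f x) volume := fun f hf =>
    (hφc.mul hf).integrable_of_hasCompactSupport h2.mul_right
  have ibp := integral_mul_fderiv_eq_neg_fderiv_mul_of_integrable (μ := (volume : Measure (Euc d)))
    (f := fun x => φ x * φ x) (g := g) (v := e)
    (by
      simp only [hφ2]
      refine (cs (fun x => 2 * fderiv ℝ φ x e * g x)
        ((continuous_const.mul hdc).mul hgc)).congr (Filter.Eventually.of_forall fun x => ?_)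
      simp only; ring)
    (by simpa [hge] using cs φ hφc)
    (by simpa [mul_assoc] using cs (fun x => φ x * g x) (hφc.mul hgc))
    (fun x _ => ((hφd x).mul (hφd x)))
    (fun x _ => (hg x).differentiableAt)
  simp only [hge, mul_one, hφ2] at ibp
  have supp : ∀ x ∉ ω, φ x = 0 := fun x hx => by
    by_contra h
    exact hx (h3 (subset_tsupport _ h))
  have hsq : ‖p.1‖ * ‖p.1‖ = ∫ x, φ x * φ x := by
    rw [← real_inner_self_eq_norm_mul_norm, L2.inner_def]
    rw [← setIntegral_eq_integral_of_forall_compl_eq_zero (s := ω) (f := fun x => φ x * φ x)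
      (fun x hx => by simp [supp x hx])]
    refine integral_congr_ae ?_
    filter_upwards [h4] with x hx
    simp [hx, pow_two]
  have hgrad : ∀ x, |fderiv ℝ φ x e| ≤ ‖gradient φ x‖ := by
    intro x
    have := (fderiv ℝ φ x).le_opNorm e
    simpa [gradient, e] using this
  have hmem1 : MemLp (fun x => ‖p.1 x‖) (ENNReal.ofReal 2) (volume.restrict ω) := by
    simpa using (Lp.memLp p.1).norm
  have hmem2 : MemLp (fun x => ‖p.2 x‖) (ENNReal.ofReal 2) (volume.restrict ω) := by
    simpa using (Lp.memLp p.2).norm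
  have hCS := integral_mul_le_Lp_mul_Lq_of_nonneg (μ := volume.restrict ω)
    Real.HolderConjugate.two_two
    (Filter.Eventually.of_forall fun x => norm_nonneg (p.1 x))
    (Filter.Eventually.of_forall fun x => norm_nonneg (p.2 x)) hmem1 hmem2
  have hint : Integrable (fun x => ‖p.1 x‖ * ‖p.2 x‖) (volume.restrict ω) :=
    MemLp.integrable_mul (p := 2) (q := 2) (Lp.memLp p.1).norm (Lp.memLp p.2).norm
  have n1 : (∫ x in ω, ‖p.1 x‖ ^ (2:ℝ)) ^ (1 / (2:ℝ)) = ‖p.1‖ := by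
    rw [Lp.norm_def, (Lp.memLp p.1).eLpNorm_eq_integral_rpow_norm (by simp) (by simp),
      ENNReal.toReal_ofReal (by positivity)]
    simp
  have n2 : (∫ x in ω, ‖p.2 x‖ ^ (2:ℝ)) ^ (1 / (2:ℝ)) = ‖p.2‖ := by
    rw [Lp.norm_def, (Lp.memLp p.2).eLpNorm_eq_integral_rpow_norm (by simp) (by simp),
      ENNReal.toReal_ofReal (by positivity)]
    simp
  rw [n1, n2] at hCS
  have hmain : ‖p.1‖ * ‖p.1‖ ≤ 2 * R * (‖p.1‖ * ‖p.2‖) := by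
    rw [hsq, ibp]
    refine (neg_le_abs _).trans ((abs_integral_le_integral_abs).trans ?_)
    rw [← setIntegral_eq_integral_of_forall_compl_eq_zero (s := ω)
      (fun x hx => by simp [supp x hx])]
    calc ∫ x in ω, |2 * φ x * fderiv ℝ φ x e * g x|
        ≤ ∫ x in ω, 2 * R * (‖p.1 x‖ * ‖p.2 x‖) := by
          refine integral_mono_of_nonneg (Filter.Eventually.of_forall fun x => abs_nonneg _)
            (hint.const_mul _) ?_
          filter_upwards [h4, h5] with x hx1 hx2
          by_cases hx : x ∈ ω
          · simp only [hx1, hx2, abs_mul]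
            have a1 : |g x| ≤ R := (by
              simpa [g] using (PiLp.norm_apply_le x 0).trans (hR x hx))
            have a2 := hgrad x
            calc |(2:ℝ)| * |φ x| * |fderiv ℝ φ x e| * |g x|
                ≤ 2 * |φ x| * ‖gradient φ x‖ * R := by
                  rw [abs_two]; gcongr
              _ = 2 * R * (‖φ x‖ * ‖gradient φ x‖) := by rw [Real.norm_eq_abs]; ring
          · simp only [supp x hx]
            simp only [mul_zero, zero_mul, abs_zero]
            positivity
      _ = 2 * R * ∫ x in ω, ‖p.1 x‖ * ‖p.2 x‖ := integral_const_mul _ _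
      _ ≤ _ := by gcongr
  have hpos : 0 < ‖p.1‖ := lt_of_le_of_ne (norm_nonneg _) (Ne.symm h0)
  have : ‖p.1‖ * ‖p.1‖ ≤ ‖p.1‖ * (2 * R * ‖p.2‖) := by linarith
  exact le_of_mul_le_mul_left this hpos

/-- Friedrichs' inequality: `W_0^{1,2}(ω)` embeds into `L²(ω)` if `ω` is bounded. -/
lemma friedrichs {d : ℕ} [NeZero d] {ω : Set (Euc d)} (hω : Bornology.IsBounded ω) :
    ∃ C : ℝ, ∀ u : W01 ω, ‖W01.toL2 u‖ ≤ C * ‖u‖ := by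
  obtain ⟨R, hR⟩ := hω.exists_norm_le
  refine ⟨2 * R, fun u => ?_⟩
  have hcl : IsClosed {p : L2 ω × Lp (Euc d) 2 (volume.restrict ω) | ‖p.1‖ ≤ 2 * R * ‖p.2‖} :=
    isClosed_le (by fun_prop) (by fun_prop)
  exact closure_minimal (friedrichs_test hR) hcl (Subtype.property u)

/-- The embedding `W_0^{1,2}(ω) → L²(ω)` for bounded `ω`. -/
noncomputable def W01.toL2CLM {d : ℕ} [NeZero d] {ω : Set (Euc d)} (hω : Bornology.IsBounded ω) :
    W01 ω →L[ℝ] L2 ω :=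
  W01.toL2.mkContinuousOfExistsBound (friedrichs hω)

/-- The dual space `W^{-1,2}(ω) = W_0^{1,2}(ω)^*` with the operator norm, that is,
`‖ξ‖ = sup {⟨ξ, g⟩ : ‖∇g‖_{L²(ω)} ≤ 1}`. -/
abbrev Wneg {d : ℕ} (ω : Set (Euc d)) := StrongDual ℝ (W01 ω)

noncomputable instance {d : ℕ} {ω : Set (Euc d)} : NormedAddCommGroup (Wneg ω) :=
  NormedAddCommGroup.ofSeparation fun f hf => by
    ext u
    have h := f.le_opNorm u
    rw [hf, zero_mul] at h
    exact norm_le_zero_iff.1 h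

/-- `u ∈ L²(Ω)` as an element of `W^{-1,2}(ω)`, `ω ⊆ Ω`: the functional `g ↦ ∫_ω u g`. -/
noncomputable def toWneg {d : ℕ} [NeZero d] {ω Ω : Set (Euc d)} (hω : Bornology.IsBounded ω)
    (h : ω ⊆ Ω) (u : L2 Ω) : Wneg ω :=
  (innerSL ℝ (restrictL2 h u)).comp (W01.toL2CLM hω)

/-! ### Time partition and the projection in time -/

/-- The reference weights `p j`, `0 ≤ j ≤ k`. -/
noncomputable def localDual (k : ℕ) : ℕ → ℝ[X] := (exists_localDual k).choose

lemma localDual_spec (k : ℕ) : IsLocalDual k (localDual k) := (exists_localDual k).choose_spec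

/-- A partition `0 = t_0 < t_1 < ⋯ < t_N = T` of the time interval into the closed intervals
`[t_n, t_{n+1}]`, `n < N`. -/
structure TimeMesh (T : ℝ) where
  N : ℕ
  node : ℕ → ℝ
  node_zero : node 0 = 0
  node_last : node N = T
  node_lt : ∀ n < N, node n < node (n + 1)

namespace TimeMesh

variable {T : ℝ} (M : TimeMesh T)

/-- The closed time interval with number `n`. -/
def K (n : ℕ) : Set ℝ := Icc (M.node n) (M.node (n + 1))

/-- Its length. -/
def h (n : ℕ) : ℝ := M.node (n + 1) - M.node n

/-- The element patch: the union of all intervals of the partition that meet `K n`. -/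
def patch (n : ℕ) : Set ℝ := ⋃ n' ∈ {n' | n' < M.N ∧ (M.K n ∩ M.K n').Nonempty}, M.K n'

/-- Shape regularity with constant `κ` (the bound `h n ≤ |patch n|` always holds). -/
def ShapeRegular (κ : ℝ) : Prop := ∀ n < M.N, volume.real (M.patch n) ≤ κ * M.h n

/-- The local coordinate in `K n`. -/
noncomputable def loc (n : ℕ) (t : ℝ) : ℝ := (t - M.node n) / M.h n

/-- The Lagrange nodes of order `k` are numbered by `0, …, N * k` from left to right; the node `i`
lies in `K n` iff `n * k ≤ i ≤ (n + 1) * k`, and then it has the local number `i - n * k`. -/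
def nodeMem (k i n : ℕ) : Prop := n * k ≤ i ∧ i ≤ (n + 1) * k

/-- Half open intervals (closed for `n = 0`), which decompose `[0, T]` disjointly; used to paste
functions that are given on each of the closed intervals. -/
def cell (n : ℕ) : Set ℝ :=
  if n = 0 then Icc (M.node 0) (M.node 1) else Ioc (M.node n) (M.node (n + 1))

open Classical in
/-- The global function on `[0, T]` that belongs to the Lagrange node `i` and is on each interval
that contains this node the transformed local polynomial with the local number of the node, and
zero on all other intervals. -/
noncomputable def paste (k : ℕ) (p : ℕ → ℝ[X]) (i : ℕ) (t : ℝ) : ℝ :=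
  ∑ n ∈ Finset.range M.N, if nodeMem k i n then
    (M.cell n).indicator (fun t => (p (i - n * k)).eval (M.loc n t)) t else 0

/-- The global Bernstein basis function of the Lagrange node `i`. -/
noncomputable def bern (k i : ℕ) : ℝ → ℝ := M.paste k (bernsteinPolynomial ℝ k) i

open Classical in
/-- The length of the support of `bern k i`, the union of the intervals that contain the node. -/
noncomputable def nodeLen (k i : ℕ) : ℝ :=
  ∑ n ∈ Finset.range M.N, if nodeMem k i n then M.h n else 0

/-- The global dual basis function of the Lagrange node `i`. -/
noncomputable def psi (k i : ℕ) (t : ℝ) : ℝ := (M.nodeLen k i)⁻¹ * M.paste k (localDual k) i t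

/-- The Scott-Zhang type projection in time, applied to a vector-valued function:
`Π v = ∑ i, ⟨v, ψ i⟩ b i`. -/
noncomputable def proj {Y : Type*} [NormedAddCommGroup Y] [NormedSpace ℝ Y] (k : ℕ) (v : ℝ → Y)
    (t : ℝ) : Y :=
  ∑ i ∈ Finset.range (M.N * k + 1), M.bern k i t • ∫ σ in Ioo 0 T, M.psi k i σ • v σ

end TimeMesh

/-! ### Bochner-Sobolev norms in time -/

/-- `g` is the `m`-th weak derivative of `f` on the open set `U`. -/
def IsWeakDeriv {X : Type*} [NormedAddCommGroup X] [NormedSpace ℝ X] (m : ℕ) (U : Set ℝ)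
    (f g : ℝ → X) : Prop :=
  LocallyIntegrableOn f U ∧ LocallyIntegrableOn g U ∧
  ∀ φ : ℝ → ℝ, ContDiff ℝ (⊤ : ℕ∞) φ → HasCompactSupport φ → tsupport φ ⊆ U →
    ∫ t in U, iteratedDeriv m φ t • f t = (-1 : ℝ) ^ m • ∫ t in U, φ t • g t

/-- `‖∂_t^m f‖_{L²(I; X)}` for an interval `I`; it takes the value `∞` if there is no such weak
derivative or if it is not square integrable. -/
noncomputable def derivNorm {X : Type*} [NormedAddCommGroup X] [NormedSpace ℝ X] (m : ℕ)
    (I : Set ℝ) (f : ℝ → X) : ℝ≥0∞ :=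
  ⨅ (g : ℝ → X) (_ : IsWeakDeriv m (interior I) f g), eLpNorm g 2 (volume.restrict I)

/-- The space `V = L²(0,T; W_0^{1,2}(Ω)) ∩ W^{1,2}(0,T; W^{-1,2}(Ω))`, as a set of functions of
time with values in `L²(Ω)`. -/
def V {d : ℕ} [NeZero d] (T : ℝ) {Ω : Set (Euc d)} (hΩ : Bornology.IsBounded Ω) :
    Set (ℝ → L2 Ω) :=
  {v | (∃ w : ℝ → W01 Ω, MemLp w 2 (volume.restrict (Ioo 0 T)) ∧
      ∀ᵐ t ∂volume.restrict (Ioo 0 T), v t = W01.toL2 (w t)) ∧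
    derivNorm 1 (Ioo 0 T) (fun t => toWneg hΩ subset_rfl (v t)) < ∞}

/-! ### Triangulations in space -/

/-- `S` is a regular (conforming) partition of `Ω` into finitely many closed `d`-simplices: each
face of the complex is a face of a `d`-simplex, and the simplices cover the closure of `Ω`. -/
structure IsTriangulation {d : ℕ} (S : Geometry.SimplicialComplex ℝ (Euc d))
    (Ω : Set (Euc d)) : Prop where
  finite : S.faces.Finite
  pure : ∀ s ∈ S.faces, ∃ t ∈ S.faces, s ⊆ t ∧ t.card = d + 1
  space_eq : S.space = closure Ω

/-- The closed `d`-simplices of the triangulation. -/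
def simplices {d : ℕ} (S : Geometry.SimplicialComplex ℝ (Euc d)) : Set (Set (Euc d)) :=
  {K | ∃ s ∈ S.faces, s.card = d + 1 ∧ K = convexHull ℝ (s : Set (Euc d))}

end SpaceTime

/-!
On the patch of `K n`, Taylor's formula at the left end point writes `f = P + R`, where `P` is a
polynomial of degree less than `s ≤ k + 1` and `R` is an `s`-fold primitive of the weak derivative
`∂ˢf`. The projection `Π` is local, and it reproduces `P`: the weights are dual to the Bernstein
basis, and at a node shared by two intervals the moment of a polynomial on either side is its value
at that node. Hence `f - Π f = R - Π R` on `K n`. Each integration over the patch gains its length,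
which is comparable to `h`, so the derivatives of `R` have the right size, and `∂ᵐΠ` costs a factor
`h⁻ᵐ`. The space `X` enters only through a continuous linear map, with which `Π` commutes.
-/

namespace SpaceTime

/-! ### Weak derivatives on the line -/

/-- `φ` is a test function on `U`, in the sense of the definition of `IsWeakDeriv`. -/
structure IsTest (U : Set ℝ) (φ : ℝ → ℝ) : Prop where
  contDiff : ContDiff ℝ (⊤ : ℕ∞) φ
  hasCompactSupport : HasCompactSupport φ
  tsupport_subset : tsupport φ ⊆ U

namespace IsTest

variable {U W : Set ℝ} {φ η : ℝ → ℝ} {a b : ℝ}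

lemma mono (h : IsTest U φ) (hUW : U ⊆ W) : IsTest W φ :=
  ⟨h.1, h.2, h.3.trans hUW⟩

lemma eq_zero (h : IsTest U φ) {t : ℝ} (ht : t ∉ U) : φ t = 0 :=
  image_eq_zero_of_notMem_tsupport fun h' => ht (h.3 h')

lemma hasDerivAt (h : IsTest U φ) (t : ℝ) : HasDerivAt φ (deriv φ t) t :=
  (h.1.differentiable (by simp) t).hasDerivAt

protected lemma deriv (h : IsTest U φ) : IsTest U (deriv φ) :=
  ⟨(contDiff_infty_iff_deriv.1 h.1).2, h.2.deriv, (tsupport_deriv_subset (𝕜 := ℝ)).trans h.3⟩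

protected lemma iteratedDeriv (h : IsTest U φ) (m : ℕ) : IsTest U (iteratedDeriv m φ) := by
  induction m with
  | zero => simpa only [iteratedDeriv_zero] using h
  | succ m ih => rw [iteratedDeriv_succ]; exact ih.deriv

lemma sub (h : IsTest U φ) (k : IsTest U η) : IsTest U (φ - η) :=
  ⟨h.1.sub k.1, h.2.sub k.2, (tsupport_sub _ _).trans (union_subset h.3 k.3)⟩

lemma const_smul (h : IsTest U φ) (c : ℝ) : IsTest U (c • φ) :=
  ⟨h.1.const_smul c, h.2.smul_left (f := fun _ => c),
    (closure_mono (Function.support_const_smul_subset c φ)).trans h.3⟩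

lemma integrable (h : IsTest U φ) : Integrable φ :=
  h.1.continuous.integrable_of_hasCompactSupport h.2

lemma exists_integral_eq_one (hab : a < b) : ∃ θ, IsTest (Ioo a b) θ ∧ ∫ t, θ t = 1 := by
  let B : ContDiffBump ((a + b) / 2) :=
    ⟨(b - a) / 8, (b - a) / 4, by linarith, by linarith⟩
  refine ⟨B.normed volume, ⟨B.contDiff_normed, B.hasCompactSupport_normed, ?_⟩,
    B.integral_normed⟩
  rw [B.tsupport_normed_eq, Real.closedBall_eq_Icc]
  exact Icc_subset_Ioo (by simp only [B]; linarith) (by simp only [B]; linarith)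

lemma primitive_eq_zero {a' b' : ℝ} (haa' : a < a') (hab' : a ≤ b')
    (hφ : ∀ t ∉ Icc a' b', φ t = 0) (h0 : ∫ t, φ t = 0) {t : ℝ} (ht : t ∉ Icc a' b') :
    ∫ σ in a..t, φ σ = 0 := by
  rcases lt_or_ge t a' with hta | hta
  · refine intervalIntegral.integral_zero_ae (Filter.Eventually.of_forall fun σ hσ => hφ σ ?_)
    rcases mem_uIoc.1 hσ with hσ | hσ <;> exact fun h => by linarith [h.1, hσ.2]
  · have hbt : b' < t := not_le.1 fun h => ht ⟨hta, h⟩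
    rw [intervalIntegral.integral_of_le (hab'.trans hbt.le), integral_Ioc_eq_integral_Ioo,
      ← integral_Icc_eq_integral_Ioo, ← h0]
    exact setIntegral_eq_integral_of_forall_compl_eq_zero fun σ hσ => hφ σ fun h =>
      hσ ⟨haa'.le.trans h.1, h.2.trans hbt.le⟩

lemma exists_deriv_eq (h : IsTest (Ioo a b) φ) (h0 : ∫ t, φ t = 0) :
    ∃ η, IsTest (Ioo a b) η ∧ deriv η = φ := by
  rcases (tsupport φ).eq_empty_or_nonempty with he | hne
  · obtain rfl : φ = 0 := tsupport_eq_empty_iff.1 he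
    exact ⟨0, h, by ext; simp⟩
  obtain ⟨a', ha', hle⟩ := h.2.isCompact.exists_isLeast hne
  obtain ⟨b', hb', hge⟩ := h.2.isCompact.exists_isGreatest hne
  have hd (t : ℝ) : HasDerivAt (fun t => ∫ σ in a..t, φ σ) (φ t) t :=
    (h.1.continuous.integral_hasStrictDerivAt a t).hasDerivAt
  have hderiv : deriv (fun t => ∫ σ in a..t, φ σ) = φ := funext fun t => (hd t).deriv
  have hzero : ∀ t ∉ Icc a' b', ∫ σ in a..t, φ σ = 0 := fun t =>
    primitive_eq_zero (h.3 ha').1 (h.3 hb').1.le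
      (fun t ht => image_eq_zero_of_notMem_tsupport fun h' => ht ⟨hle h', hge h'⟩) h0
  have hsupp : tsupport (fun t => ∫ σ in a..t, φ σ) ⊆ Icc a' b' :=
    closure_minimal (fun t ht => not_not.1 fun h' => ht (hzero t h')) isClosed_Icc
  refine ⟨_, ⟨contDiff_infty_iff_deriv.2 ⟨fun t => (hd t).differentiableAt, ?_⟩,
    .intro' isCompact_Icc isClosed_Icc hzero, ?_⟩, hderiv⟩
  · exact hderiv.symm ▸ h.1
  · exact hsupp.trans (Icc_subset_Ioo (h.3 ha').1 (h.3 hb').2)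

variable {X : Type*} [NormedAddCommGroup X] [NormedSpace ℝ X] {f : ℝ → X}

lemma setIntegral_smul (h : IsTest U φ) (f : ℝ → X) :
    ∫ t in U, φ t • f t = ∫ t, φ t • f t :=
  setIntegral_eq_integral_of_forall_compl_eq_zero fun t ht => by rw [h.eq_zero ht, zero_smul]

lemma integrable_smul (h : IsTest U φ) (hf : LocallyIntegrableOn f U) :
    Integrable fun t => φ t • f t := by
  have hK : IntegrableOn (fun t => φ t • f t) (tsupport φ) :=
    (hf.integrableOn_compact_subset h.3 h.2).continuousOn_smul h.1.continuous.continuousOn h.2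
  refine (integrableOn_iff_integrable_of_support_subset ?_).1 hK
  exact (Function.support_smul_subset_left _ _).trans (subset_tsupport φ)

end IsTest

lemma locallyIntegrableOn_congr {X : Type*} [NormedAddCommGroup X] {f f' : ℝ → X} {U : Set ℝ}
    (h : LocallyIntegrableOn f U) (hf : f =ᵐ[volume.restrict U] f') :
    LocallyIntegrableOn f' U := fun x hx => by
  obtain ⟨s, hs, hi⟩ := h x hx
  refine ⟨s ∩ U, Filter.inter_mem hs self_mem_nhdsWithin, ?_⟩
  exact (hi.mono_set inter_subset_left).congr_fun_ae
    (ae_restrict_of_ae_restrict_of_subset inter_subset_right hf)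

section IsWeakDeriv

variable {X : Type*} [NormedAddCommGroup X] [NormedSpace ℝ X] {U W : Set ℝ} {m : ℕ}
  {f g f' g' : ℝ → X}

lemma isWeakDeriv_iff : IsWeakDeriv m U f g ↔ LocallyIntegrableOn f U ∧ LocallyIntegrableOn g U ∧
    ∀ φ, IsTest U φ → ∫ t, iteratedDeriv m φ t • f t = (-1 : ℝ) ^ m • ∫ t, φ t • g t := by
  refine and_congr_right fun _ => and_congr_right fun _ =>
    ⟨fun h φ hφ => ?_, fun h φ h1 h2 h3 => ?_⟩
  · rw [← (hφ.iteratedDeriv m).setIntegral_smul, ← hφ.setIntegral_smul]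
    exact h φ hφ.1 hφ.2 hφ.3
  · have hφ : IsTest U φ := ⟨h1, h2, h3⟩
    rw [(hφ.iteratedDeriv m).setIntegral_smul, hφ.setIntegral_smul]
    exact h φ hφ

lemma IsWeakDeriv.mono (h : IsWeakDeriv m U f g) (hWU : W ⊆ U) : IsWeakDeriv m W f g := by
  rw [isWeakDeriv_iff] at h ⊢
  exact ⟨h.1.mono_set hWU, h.2.1.mono_set hWU, fun φ hφ => h.2.2 φ (hφ.mono hWU)⟩

lemma IsWeakDeriv.congr (h : IsWeakDeriv m U f g) (hf : f =ᵐ[volume.restrict U] f') :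
    IsWeakDeriv m U f' g := by
  refine ⟨locallyIntegrableOn_congr h.1 hf, h.2.1, fun φ h1 h2 h3 => ?_⟩
  rw [← h.2.2 φ h1 h2 h3]
  refine integral_congr_ae ?_
  filter_upwards [hf] with t ht
  rw [ht]

lemma IsWeakDeriv.sub (h : IsWeakDeriv m U f g) (h' : IsWeakDeriv m U f' g') :
    IsWeakDeriv m U (f - f') (g - g') := by
  rw [isWeakDeriv_iff] at h h' ⊢
  refine ⟨h.1.sub h'.1, h.2.1.sub h'.2.1, fun φ hφ => ?_⟩
  simp only [Pi.sub_apply, smul_sub]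
  rw [integral_sub ((hφ.iteratedDeriv m).integrable_smul h.1)
      ((hφ.iteratedDeriv m).integrable_smul h'.1),
    integral_sub (hφ.integrable_smul h.2.1) (hφ.integrable_smul h'.2.1), h.2.2 φ hφ, h'.2.2 φ hφ,
    smul_sub]

lemma isWeakDeriv_of_hasDerivAt {F : ℕ → ℝ → X} (hF : ∀ j t, HasDerivAt (F j) (F (j + 1) t) t)
    (m : ℕ) (U : Set ℝ) : IsWeakDeriv m U (F 0) (F m) := by
  have hcont (j : ℕ) : Continuous (F j) :=
    continuous_iff_continuousAt.2 fun t => (hF j t).continuousAt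
  have hloc (j : ℕ) : LocallyIntegrableOn (F j) U :=
    (hcont j).locallyIntegrable.locallyIntegrableOn U
  refine isWeakDeriv_iff.2 ⟨hloc 0, hloc m, ?_⟩
  induction m with
  | zero => simp
  | succ m ih =>
    intro φ hφ
    have hparts := integral_bilinear_hasDerivAt_right_eq_neg_left_of_integrable
      (L := ContinuousLinearMap.lsmul ℝ ℝ) (fun t _ => hφ.hasDerivAt t) (fun t _ => hF m t)
      (hφ.integrable_smul (hloc _)) (hφ.deriv.integrable_smul (hloc _))
      (hφ.integrable_smul (hloc _))
    simp only [ContinuousLinearMap.lsmul_apply] at hparts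
    rw [iteratedDeriv_succ', ih _ hφ.deriv, hparts, pow_succ, mul_neg_one, neg_smul, smul_neg,
      neg_neg]

/-- The `m`-th derivative turns into a constant, because up to multiples of a fixed test function
`θ` every test function is the derivative of a test function. -/
lemma IsWeakDeriv.exists_const [CompleteSpace X] {a b : ℝ} (hab : a < b)
    (h : IsWeakDeriv (m + 1) (Ioo a b) f 0) :
    ∃ c : X, IsWeakDeriv m (Ioo a b) f fun _ => c := by
  rw [isWeakDeriv_iff] at h
  obtain ⟨hf, -, hweak⟩ := h
  obtain ⟨θ, hθ, hθ1⟩ := IsTest.exists_integral_eq_one hab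
  refine ⟨(-1 : ℝ) ^ m • ∫ t, iteratedDeriv m θ t • f t, isWeakDeriv_iff.2 ⟨hf,
    (locallyIntegrable_const _).locallyIntegrableOn _, fun φ hφ => ?_⟩⟩
  obtain ⟨η, hη, hηφ⟩ := (hφ.sub (hθ.const_smul (∫ t, φ t))).exists_deriv_eq (by
    simp only [Pi.sub_apply, Pi.smul_apply]
    rw [integral_sub hφ.integrable (hθ.integrable.fun_smul _), integral_smul, hθ1, smul_eq_mul,
      mul_one, sub_self])
  have hCm {χ : ℝ → ℝ} (hχ : IsTest (Ioo a b) χ) (t : ℝ) : ContDiffAt ℝ m χ t :=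
    (hχ.1.of_le (by exact_mod_cast le_top)).contDiffAt
  have hsplit (t : ℝ) : iteratedDeriv m (φ - (∫ t, φ t) • θ) t • f t
      = iteratedDeriv m φ t • f t - (∫ t, φ t) • iteratedDeriv m θ t • f t := by
    rw [iteratedDeriv_sub (hCm hφ t) (hCm (hθ.const_smul _) t),
      iteratedDeriv_const_smul_field, sub_smul, smul_assoc]
  have hzero := hweak η hη
  simp only [iteratedDeriv_succ', hηφ, hsplit, Pi.zero_apply, smul_zero, integral_zero] at hzero
  rw [integral_sub ((hφ.iteratedDeriv m).integrable_smul hf)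
    (((hθ.iteratedDeriv m).integrable_smul hf).fun_smul _), integral_smul, sub_eq_zero] at hzero
  rw [hzero, integral_smul_const, smul_comm ((-1 : ℝ) ^ m), smul_smul ((-1 : ℝ) ^ m), ← mul_pow,
    neg_one_mul, neg_neg, one_pow, one_smul]

lemma isWeakDeriv_pow_smul (m : ℕ) (U : Set ℝ) (x : X) :
    IsWeakDeriv m U (fun t => t ^ m • x) fun _ => (m.factorial : ℝ) • x := by
  have h := isWeakDeriv_of_hasDerivAt
    (F := fun j t => (Polynomial.derivative^[j] (Polynomial.X ^ m : ℝ[X])).eval t • x)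
    (fun j t => by
      rw [Function.iterate_succ_apply']
      exact (Polynomial.hasDerivAt _ t).smul_const x) m U
  simpa [Polynomial.iterate_derivative_X_pow_eq_smul, Nat.descFactorial_self] using h

/-- A version of the **du Bois-Reymond lemma**. -/
lemma IsWeakDeriv.exists_ae_eq_polynomial [CompleteSpace X] {a b : ℝ} (hab : a < b)
    (h : IsWeakDeriv m (Ioo a b) f 0) :
    ∃ c : ℕ → X, f =ᵐ[volume.restrict (Ioo a b)] fun t => ∑ i ∈ Finset.range m, t ^ i • c i := by
  induction m generalizing f with
  | zero =>
    rw [isWeakDeriv_iff] at h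
    have hae := isOpen_Ioo.ae_eq_zero_of_integral_contDiff_smul_eq_zero h.1 fun φ h1 h2 h3 => by
      simpa using h.2.2 φ ⟨h1, h2, h3⟩
    exact ⟨0, by simpa [Filter.EventuallyEq] using (ae_restrict_iff' measurableSet_Ioo).2 hae⟩
  | succ m ih =>
    obtain ⟨x, hx⟩ := h.exists_const hab
    have hsub := hx.sub (isWeakDeriv_pow_smul m (Ioo a b) ((m.factorial : ℝ)⁻¹ • x))
    have hfac : (m.factorial : ℝ) ≠ 0 := by positivity
    rw [show (fun _ : ℝ => x) - (fun _ => (m.factorial : ℝ) • (m.factorial : ℝ)⁻¹ • x) = 0 by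
      ext; simp [smul_inv_smul₀ hfac]] at hsub
    obtain ⟨c, hc⟩ := ih hsub
    refine ⟨Function.update c m ((m.factorial : ℝ)⁻¹ • x), ?_⟩
    filter_upwards [hc] with t ht
    rw [Finset.sum_range_succ, Function.update_self, Finset.sum_congr rfl fun i hi => by
      rw [Function.update_of_ne (Finset.mem_range.1 hi).ne], ← ht, Pi.sub_apply, sub_add_cancel]

end IsWeakDeriv

/-! ### Taylor's formula -/

section Taylor

variable {X : Type*} [NormedAddCommGroup X] [NormedSpace ℝ X] {a b : ℝ} {f g : ℝ → X}
  {m s : ℕ} {p : ℝ≥0∞}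

lemma integral_deriv_smul_setIntegral_Iic [CompleteSpace X] (hg : Integrable g) {φ : ℝ → ℝ}
    {U : Set ℝ} (hφ : IsTest U φ) :
    ∫ t, deriv φ t • ∫ σ in Iic t, g σ = -∫ t, φ t • g t := by
  have hint : Integrable (Function.uncurry fun t σ => deriv φ t • (Iic t).indicator g σ)
      (volume.prod volume) := by
    refine ((hφ.deriv.integrable.smul_prod hg).indicator (s := {z : ℝ × ℝ | z.2 ≤ z.1})
      (measurableSet_le measurable_snd measurable_fst)).congr
      (Filter.Eventually.of_forall fun z => ?_)
    by_cases h : z.2 ≤ z.1 <;> simp [Function.uncurry, h]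
  calc ∫ t, deriv φ t • ∫ σ in Iic t, g σ
      = ∫ t, ∫ σ, deriv φ t • (Iic t).indicator g σ := by
        simp only [integral_smul, integral_indicator measurableSet_Iic]
    _ = ∫ σ, ∫ t, (Ici σ).indicator (fun t => deriv φ t • g σ) t := by
        rw [integral_integral_swap hint]
        refine integral_congr_ae (Filter.Eventually.of_forall fun σ => integral_congr_ae
          (Filter.Eventually.of_forall fun t => ?_))
        by_cases h : σ ≤ t <;> simp [h]
    _ = ∫ σ, -(φ σ • g σ) := by
        refine integral_congr_ae (Filter.Eventually.of_forall fun σ => ?_)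
        simp only [integral_indicator measurableSet_Ici]
        rw [integral_smul_const, integral_Ici_eq_integral_Ioi,
          hφ.2.integral_Ioi_deriv_eq (hφ.1.of_le (by exact_mod_cast le_top)), neg_smul]
    _ = -∫ t, φ t • g t := integral_neg _

lemma integral_deriv_smul_primitive [CompleteSpace X] (hg : IntegrableOn g (Ioo a b)) {φ : ℝ → ℝ}
    (hφ : IsTest (Ioo a b) φ) :
    ∫ t, deriv φ t • ∫ σ in a..t, g σ = -∫ t, φ t • g t := by
  have hprim (t : ℝ) (ht : t ∈ Ioo a b) :
      ∫ σ in a..t, g σ = ∫ σ in Iic t, (Ioo a b).indicator g σ := by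
    rw [setIntegral_indicator measurableSet_Ioo, intervalIntegral.integral_of_le ht.1.le]
    congr 2
    ext σ
    exact ⟨fun h => ⟨h.2, h.1, h.2.trans_lt ht.2⟩, fun h => ⟨h.2.1, h.1⟩⟩
  rw [← hφ.deriv.setIntegral_smul, setIntegral_congr_fun measurableSet_Ioo fun t ht => by
    rw [hprim t ht], hφ.deriv.setIntegral_smul, integral_deriv_smul_setIntegral_Iic
    ((integrable_indicator_iff measurableSet_Ioo).2 hg) hφ, ← hφ.setIntegral_smul,
    ← hφ.setIntegral_smul]
  exact congrArg _ (setIntegral_congr_fun measurableSet_Ioo fun t ht => by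
    rw [indicator_of_mem ht])

/-- The `j`-fold iterated primitive of `g` with starting point `a`; it is the remainder in Taylor's
formula for the expansion point `a`. -/
noncomputable def iterPrim (a : ℝ) (g : ℝ → X) : ℕ → ℝ → X
  | 0 => g
  | j + 1 => fun t => ∫ σ in a..t, iterPrim a g j σ

lemma integrableOn_iterPrim (hg : IntegrableOn g (Ioo a b)) (j : ℕ) :
    IntegrableOn (iterPrim a g j) (Ioo a b) := by
  induction j with
  | zero => exact hg
  | succ j ih =>
    rcases le_total b a with hab | hab
    · simp only [Ioo_eq_empty hab.not_gt, integrableOn_empty]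
    have hcont : ContinuousOn (iterPrim a g (j + 1)) (uIcc a b) :=
      intervalIntegral.continuousOn_primitive_interval (by
        rwa [uIcc_of_le hab, integrableOn_Icc_iff_integrableOn_Ioo])
    exact (hcont.integrableOn_compact isCompact_uIcc).mono_set
      (Ioo_subset_Icc_self.trans Icc_subset_uIcc)

lemma isWeakDeriv_iterPrim [CompleteSpace X] (hg : IntegrableOn g (Ioo a b)) (hms : m ≤ s) :
    IsWeakDeriv m (Ioo a b) (iterPrim a g s) (iterPrim a g (s - m)) := by
  refine isWeakDeriv_iff.2 ⟨(integrableOn_iterPrim hg s).locallyIntegrableOn,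
    (integrableOn_iterPrim hg _).locallyIntegrableOn, ?_⟩
  induction m with
  | zero => simp
  | succ m ih =>
    intro φ hφ
    obtain ⟨j, hj⟩ : ∃ j, s - m = j + 1 := ⟨s - m - 1, by omega⟩
    rw [iteratedDeriv_succ', ih (by omega) _ hφ.deriv, hj, show s - (m + 1) = j by omega, iterPrim,
      integral_deriv_smul_primitive (integrableOn_iterPrim hg j) hφ, pow_succ, mul_neg_one,
      neg_smul, smul_neg]

lemma IsWeakDeriv.exists_taylor [CompleteSpace X] (hab : a < b) (h : IsWeakDeriv s (Ioo a b) f g)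
    (hg : IntegrableOn g (Ioo a b)) :
    ∃ c : ℕ → X, f =ᵐ[volume.restrict (Ioo a b)]
      fun t => ∑ i ∈ Finset.range s, t ^ i • c i + iterPrim a g s t := by
  have hsub := h.sub (isWeakDeriv_iterPrim hg le_rfl)
  rw [Nat.sub_self, iterPrim, sub_self] at hsub
  obtain ⟨c, hc⟩ := hsub.exists_ae_eq_polynomial hab
  refine ⟨c, ?_⟩
  filter_upwards [hc] with t ht
  rw [← ht, Pi.sub_apply, sub_add_cancel]

lemma eLpNorm_le_of_enorm_le_lintegral {α β E F : Type*} [MeasurableSpace α] [MeasurableSpace β]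
    [NormedAddCommGroup E] [NormedAddCommGroup F] {μ : Measure α} {ν : Measure β} {f : α → E}
    {g : β → F} {c : ℝ≥0∞} (hp : 1 ≤ p) (hνμ : ν univ ≤ μ univ) (hf : AEStronglyMeasurable f μ)
    (hg : ∀ᵐ x ∂ν, ‖g x‖ₑ ≤ c * ∫⁻ y, ‖f y‖ₑ ∂μ) :
    eLpNorm g p ν ≤ c * μ univ * eLpNorm f p μ := by
  have hp' : p.toReal⁻¹ ≤ 1 := by
    rcases eq_or_ne p ∞ with rfl | h
    · simp
    · exact inv_le_one_of_one_le₀ (by simpa using ENNReal.toReal_mono h hp)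
  have hHölder : ∫⁻ y, ‖f y‖ₑ ∂μ ≤ eLpNorm f p μ * μ univ ^ (1 - p.toReal⁻¹) := by
    simpa [eLpNorm_one_eq_lintegral_enorm] using eLpNorm_le_eLpNorm_mul_rpow_measure_univ hp hf
  calc eLpNorm g p ν
      ≤ (c * ∫⁻ y, ‖f y‖ₑ ∂μ) * ν univ ^ p.toReal⁻¹ := eLpNorm_le_of_ae_enorm_bound hg
    _ ≤ (c * (eLpNorm f p μ * μ univ ^ (1 - p.toReal⁻¹))) * μ univ ^ p.toReal⁻¹ := by gcongr
    _ = c * μ univ * eLpNorm f p μ := by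
        rw [mul_assoc, mul_assoc,
          ← ENNReal.rpow_add_of_nonneg _ _ (sub_nonneg.2 hp') (by positivity), sub_add_cancel,
          ENNReal.rpow_one, mul_comm (eLpNorm f p μ), mul_assoc]

lemma eLpNorm_primitive_le (hp : 1 ≤ p)
    (hg : AEStronglyMeasurable g (volume.restrict (Ioo a b))) :
    eLpNorm (fun t => ∫ σ in a..t, g σ) p (volume.restrict (Ioo a b)) ≤
      ENNReal.ofReal (b - a) * eLpNorm g p (volume.restrict (Ioo a b)) := by
  have h := eLpNorm_le_of_enorm_le_lintegral (g := fun t => ∫ σ in a..t, g σ) (c := 1) hp le_rfl hg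
    ((ae_restrict_mem measurableSet_Ioo).mono fun t ht => by
      rw [intervalIntegral.integral_of_le ht.1.le, one_mul]
      exact (enorm_integral_le_lintegral_enorm _).trans
        (lintegral_mono_set fun σ hσ => ⟨hσ.1, hσ.2.trans_lt ht.2⟩))
  rwa [one_mul, Measure.restrict_apply_univ, Real.volume_Ioo] at h

lemma eLpNorm_iterPrim_le (hp : 1 ≤ p) (hg : IntegrableOn g (Ioo a b)) (j : ℕ) :
    eLpNorm (iterPrim a g j) p (volume.restrict (Ioo a b)) ≤
      ENNReal.ofReal (b - a) ^ j * eLpNorm g p (volume.restrict (Ioo a b)) := by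
  induction j with
  | zero => rw [pow_zero, one_mul, iterPrim]
  | succ j ih =>
    calc eLpNorm (iterPrim a g (j + 1)) p (volume.restrict (Ioo a b))
        ≤ ENNReal.ofReal (b - a) * eLpNorm (iterPrim a g j) p (volume.restrict (Ioo a b)) :=
          eLpNorm_primitive_le hp (integrableOn_iterPrim hg j).1
      _ ≤ ENNReal.ofReal (b - a) *
            (ENNReal.ofReal (b - a) ^ j * eLpNorm g p (volume.restrict (Ioo a b))) := by gcongr
      _ = ENNReal.ofReal (b - a) ^ (j + 1) * eLpNorm g p (volume.restrict (Ioo a b)) := by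
          rw [pow_succ', mul_assoc]

end Taylor

/-! ### Bernstein polynomials and their dual weights -/

section Bernstein

open Polynomial

variable {k : ℕ} {q : ℝ[X]}

lemma natDegree_bernsteinPolynomial_le {j : ℕ} (hj : j ≤ k) :
    (bernsteinPolynomial ℝ k j).natDegree ≤ k := by
  have hX : ((1 - X : ℝ[X]) ^ (k - j)).natDegree ≤ (k - j) * 1 :=
    natDegree_pow_le_of_le _ ((natDegree_sub_le _ _).trans (by simp))
  calc (bernsteinPolynomial ℝ k j).natDegree
      ≤ 0 + j + (k - j) * 1 :=
        natDegree_mul_le_of_le (natDegree_mul_le_of_le (by simp) (by simp)) hX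
    _ = k := by omega

lemma span_bernsteinPolynomial (k : ℕ) :
    Submodule.span ℝ (range fun j : Fin (k + 1) => bernsteinPolynomial ℝ k j) =
      degreeLT ℝ (k + 1) := by
  have hindep : LinearIndependent ℝ fun j : Fin (k + 1) => bernsteinPolynomial ℝ k j :=
    Fintype.linearIndependent_iff.2 fun c hc => congrFun (bernstein_indep k c hc)
  have : Module.Finite ℝ (degreeLT ℝ (k + 1)) := .equiv (degreeLTEquiv ℝ (k + 1)).symm
  refine Submodule.eq_of_le_of_finrank_eq (Submodule.span_le.2 ?_) ?_
  · rintro _ ⟨j, rfl⟩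
    exact mem_degreeLT.2 (degree_le_natDegree.trans_lt (by
      exact_mod_cast Nat.lt_succ_of_le (natDegree_bernsteinPolynomial_le (Nat.le_of_lt_succ j.2))))
  · rw [finrank_span_eq_card hindep, (degreeLTEquiv ℝ (k + 1)).finrank_eq, Module.finrank_fin_fun,
      Fintype.card_fin]

lemma sum_ip_localDual_smul_bernsteinPolynomial (hq : q.natDegree ≤ k) :
    ∑ j ∈ Finset.range (k + 1), ip (localDual k j) q • bernsteinPolynomial ℝ k j = q := by
  have hmem : q ∈ Submodule.span ℝ (range fun j : Fin (k + 1) => bernsteinPolynomial ℝ k j) := by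
    rw [span_bernsteinPolynomial]
    exact mem_degreeLT.2 (degree_le_natDegree.trans_lt (by exact_mod_cast Nat.lt_succ_of_le hq))
  obtain ⟨c, rfl⟩ := (Submodule.mem_span_range_iff_exists_fun ℝ).1 hmem
  rw [Finset.sum_range]
  refine Finset.sum_congr rfl fun i _ => ?_
  rw [← ipL_apply, map_sum, Finset.sum_congr rfl fun j _ => by
    rw [map_smul, ipL_apply, (localDual_spec k).2 i (Nat.le_of_lt_succ i.2) j
      (Nat.le_of_lt_succ j.2)]]
  simp [Fin.val_inj]

lemma ip_localDual_zero (hq : q.natDegree ≤ k) : ip (localDual k 0) q = q.eval 0 := by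
  conv_rhs => rw [← sum_ip_localDual_smul_bernsteinPolynomial hq]
  simp [eval_finsetSum, bernsteinPolynomial.eval_at_0]

lemma ip_localDual_self (hq : q.natDegree ≤ k) : ip (localDual k k) q = q.eval 1 := by
  conv_rhs => rw [← sum_ip_localDual_smul_bernsteinPolynomial hq]
  simp [eval_finsetSum, bernsteinPolynomial.eval_at_1]

lemma exists_forall_abs_eval_le {ι : Type*} (s : Finset ι) (p : ι → ℝ[X]) :
    ∃ c : ℝ, 0 ≤ c ∧ ∀ i ∈ s, ∀ x ∈ Icc (0 : ℝ) 1, |(p i).eval x| ≤ c := by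
  have hbound (i : ι) : ∃ c : ℝ, ∀ x ∈ Icc (0 : ℝ) 1, |(p i).eval x| ≤ c :=
    isCompact_Icc.exists_bound_of_continuousOn (p i).continuous.continuousOn
  choose c hc using hbound
  have hc0 (i : ι) : 0 ≤ c i := (abs_nonneg _).trans (hc i 0 (by simp))
  exact ⟨∑ i ∈ s, c i, Finset.sum_nonneg fun i _ => hc0 i, fun i hi x hx =>
    (hc i x hx).trans (Finset.single_le_sum (fun j _ => hc0 j) hi)⟩

end Bernstein

namespace TimeMesh

variable {T : ℝ} (M : TimeMesh T) {n : ℕ}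

/-! ### Geometry of the partition -/

lemma node_lt_node {i j : ℕ} (hij : i < j) (hj : j ≤ M.N) : M.node i < M.node j :=
  strictMonoOn_Iic_of_lt_succ M.node_lt (mem_Iic.2 (hij.le.trans hj)) (mem_Iic.2 hj) hij

lemma node_mono {i j : ℕ} (hij : i ≤ j) (hj : j ≤ M.N) : M.node i ≤ M.node j := by
  rcases hij.eq_or_lt with rfl | h
  · exact le_rfl
  · exact (M.node_lt_node h hj).le

lemma h_pos (hn : n < M.N) : 0 < M.h n := sub_pos.2 (M.node_lt n hn)

/-- The interior of `K n`. -/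
def openK (n : ℕ) : Set ℝ := Ioo (M.node n) (M.node (n + 1))

/-- The left end point of `patch n`. Truncated subtraction accounts for `n = 0`. -/
def left (n : ℕ) : ℝ := M.node (n - 1)

/-- The right end point of `patch n`. -/
def right (n : ℕ) : ℝ := M.node (min (n + 2) M.N)

lemma left_le (hn : n < M.N) : M.left n ≤ M.node n := M.node_mono (by omega) (by omega)

lemma le_right (hn : n < M.N) : M.node (n + 1) ≤ M.right n := M.node_mono (by omega) (by omega)

lemma left_lt_right (hn : n < M.N) : M.left n < M.right n :=
  (M.left_le hn).trans_lt ((M.node_lt n hn).trans_le (M.le_right hn))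

lemma zero_le_left (hn : n < M.N) : 0 ≤ M.left n :=
  M.node_zero.symm.trans_le (M.node_mono (by omega) (by omega))

lemma right_le : M.right n ≤ T :=
  (M.node_mono (by omega) le_rfl).trans_eq M.node_last

lemma K_subset {n' : ℕ} (hn : n < M.N) (hn' : n' < M.N) (h : n ≤ n' + 1) (h' : n' ≤ n + 1) :
    M.K n' ⊆ Icc (M.left n) (M.right n) :=
  Icc_subset_Icc (M.node_mono (by omega) (by omega)) (M.node_mono (by omega) (by omega))

lemma K_subset_Icc (hn : n < M.N) : M.K n ⊆ Icc 0 T :=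
  (M.K_subset hn hn (by omega) (by omega)).trans (Icc_subset_Icc (M.zero_le_left hn) M.right_le)

lemma openK_subset (hn : n < M.N) : M.openK n ⊆ Ioo (M.left n) (M.right n) :=
  Ioo_subset_Ioo (M.left_le hn) (M.le_right hn)

lemma le_add_one_of_mem_K {n' : ℕ} (hn : n < M.N) {t : ℝ} (ht : t ∈ M.K n)
    (ht' : t ∈ M.K n') : n ≤ n' + 1 := by
  by_contra! hlt
  exact (M.node_lt_node hlt hn.le).not_ge (ht.1.trans ht'.2)

lemma Icc_left_right_subset_patch (hn : n < M.N) : Icc (M.left n) (M.right n) ⊆ M.patch n := by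
  have hmem {i : ℕ} (hi : i < M.N) : M.node i ∈ M.K i ∧ M.node (i + 1) ∈ M.K i :=
    ⟨left_mem_Icc.2 (M.node_lt i hi).le, right_mem_Icc.2 (M.node_lt i hi).le⟩
  intro t ht
  simp only [patch, mem_iUnion, mem_ofPred_eq, exists_prop]
  rcases le_or_gt (M.node n) t with htn | htn
  · rcases le_or_gt t (M.node (n + 1)) with htn' | htn'
    · exact ⟨n, ⟨hn, _, (hmem hn).1, (hmem hn).1⟩, htn, htn'⟩
    · have hN : n + 1 < M.N := lt_of_not_ge fun h => htn'.not_ge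
        (ht.2.trans_eq (congrArg M.node (by omega)))
      exact ⟨n + 1, ⟨hN, _, (hmem hn).2, (hmem hN).1⟩, htn'.le,
        ht.2.trans_eq (congrArg M.node (by omega))⟩
  · obtain ⟨l, rfl⟩ : ∃ l, n = l + 1 := Nat.exists_eq_succ_of_ne_zero fun h0 => by
      subst h0
      exact htn.not_ge ht.1
    exact ⟨l, ⟨by omega, _, (hmem hn).1, (hmem (by omega)).2⟩, ht.1, htn.le⟩

lemma patch_eq (hn : n < M.N) : M.patch n = Icc (M.left n) (M.right n) := by
  refine (iUnion₂_subset ?_).antisymm (M.Icc_left_right_subset_patch hn)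
  rintro n' ⟨hn', t, ht, ht'⟩
  exact M.K_subset hn hn' (M.le_add_one_of_mem_K hn ht ht') (M.le_add_one_of_mem_K hn' ht' ht)

lemma h_le (hn : n < M.N) : M.h n ≤ M.right n - M.left n :=
  sub_le_sub (M.le_right hn) (M.left_le hn)

lemma ShapeRegular.right_sub_left_le {M : TimeMesh T} {κ : ℝ} (hM : M.ShapeRegular κ)
    (hn : n < M.N) : M.right n - M.left n ≤ κ * M.h n := by
  have h := hM n hn
  rwa [M.patch_eq hn, Real.volume_real_Icc_of_le (M.left_lt_right hn).le] at h

lemma ShapeRegular.one_le {M : TimeMesh T} {κ : ℝ} (hM : M.ShapeRegular κ) (hn : n < M.N) :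
    1 ≤ κ :=
  le_of_mul_le_mul_right ((one_mul (M.h n)).trans_le ((M.h_le hn).trans (hM.right_sub_left_le hn)))
    (M.h_pos hn)

/-! ### Global basis functions and dual weights -/

lemma loc_mem (hn : n < M.N) {t : ℝ} (ht : t ∈ M.K n) : M.loc n t ∈ Icc (0 : ℝ) 1 :=
  ⟨div_nonneg (sub_nonneg.2 ht.1) (M.h_pos hn).le,
    (div_le_one (M.h_pos hn)).2 (sub_le_sub_right ht.2 _)⟩

lemma openK_subset_cell (n : ℕ) : M.openK n ⊆ M.cell n := by
  unfold cell openK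
  split_ifs with h
  · subst h; exact Ioo_subset_Icc_self
  · exact Ioo_subset_Ioc_self

lemma cell_subset_K (n : ℕ) : M.cell n ⊆ M.K n := by
  unfold cell K
  split_ifs with h
  · subst h; exact subset_rfl
  · exact Ioc_subset_Icc_self

lemma measurableSet_cell (n : ℕ) : MeasurableSet (M.cell n) := by
  unfold cell
  split_ifs
  exacts [measurableSet_Icc, measurableSet_Ioc]

lemma setIntegral_cell {E : Type*} [NormedAddCommGroup E] [NormedSpace ℝ E] (hn : n < M.N)
    (F : ℝ → E) : ∫ t in M.cell n, F t = ∫ t in M.node n..M.node (n + 1), F t := by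
  rw [intervalIntegral.integral_of_le (M.node_lt n hn).le]
  unfold cell
  split_ifs with h
  · rw [integral_Icc_eq_integral_Ioc, h]
  · rfl

lemma cell_disjoint {n' : ℕ} (hn' : n' < M.N) (h : n < n') :
    Disjoint (M.cell n) (M.cell n') := by
  refine Set.disjoint_left.2 fun t ht ht' => ?_
  rw [cell, if_neg (by omega)] at ht'
  exact ((M.cell_subset_K n ht).2.trans (M.node_mono h hn'.le)).not_gt ht'.1

section Paste

variable {k i : ℕ} {p : ℕ → ℝ[X]} {t : ℝ}

lemma nodeMem_iff_exists : nodeMem k i n ↔ ∃ j ≤ k, i = n * k + j := by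
  rw [nodeMem, add_one_mul]
  exact ⟨fun h => ⟨i - n * k, by omega, by omega⟩, by rintro ⟨j, hj, rfl⟩; omega⟩

lemma nodeMem.le_add_one {n' : ℕ} (hk : 1 ≤ k) (h : nodeMem k i n) (h' : nodeMem k i n') :
    n ≤ n' + 1 :=
  le_of_mul_le_mul_right (h.1.trans h'.2) hk

lemma paste_of_mem_cell [Decidable (nodeMem k i n)] (hn : n < M.N) (ht : t ∈ M.cell n) :
    M.paste k p i t = if nodeMem k i n then (p (i - n * k)).eval (M.loc n t) else 0 := by
  rw [paste, Finset.sum_eq_single_of_mem n (Finset.mem_range.2 hn), indicator_of_mem ht]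
  · congr
  · intro n' hn' hne
    rw [indicator_of_notMem, ite_self]
    rcases lt_or_gt_of_ne hne with h | h
    · exact fun ht' => Set.disjoint_left.1 (M.cell_disjoint hn h) ht' ht
    · exact Set.disjoint_left.1 (M.cell_disjoint (Finset.mem_range.1 hn') h) ht

lemma paste_eq_zero (h : ∀ n < M.N, nodeMem k i n → t ∉ M.cell n) : M.paste k p i t = 0 := by
  refine Finset.sum_eq_zero fun n hn => ?_
  split_ifs with hi
  · exact indicator_of_notMem (h n (Finset.mem_range.1 hn) hi) _
  · rfl

lemma paste_eq_zero_of_notMem_patch (hk : 1 ≤ k) (hn : n < M.N) (hi : nodeMem k i n)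
    (ht : t ∉ Icc (M.left n) (M.right n)) : M.paste k p i t = 0 :=
  M.paste_eq_zero fun n' hn' hi' ht' => ht (M.K_subset hn hn' (nodeMem.le_add_one hk hi hi')
    (nodeMem.le_add_one hk hi' hi) (M.cell_subset_K n' ht'))

lemma abs_paste_le {c : ℝ} (hc : ∀ j ∈ Finset.range (k + 1), ∀ x ∈ Icc (0 : ℝ) 1,
    |(p j).eval x| ≤ c) (i : ℕ) (t : ℝ) :
    |M.paste k p i t| ≤ c := by
  classical
  by_cases h : ∃ n < M.N, nodeMem k i n ∧ t ∈ M.cell n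
  · obtain ⟨n, hn, hi, ht⟩ := h
    rw [M.paste_of_mem_cell hn ht, if_pos hi]
    obtain ⟨j, hj, rfl⟩ := nodeMem_iff_exists.1 hi
    rw [Nat.add_sub_cancel_left]
    exact hc j (Finset.mem_range_succ_iff.2 hj) _ (M.loc_mem hn (M.cell_subset_K n ht))
  · rw [M.paste_eq_zero fun n hn hi ht => h ⟨n, hn, hi, ht⟩, abs_zero]
    exact (abs_nonneg _).trans (hc 0 (by simp) 0 (by simp))

@[fun_prop]
lemma continuous_loc (n : ℕ) : Continuous (M.loc n) := by
  unfold loc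
  fun_prop

lemma measurable_paste (k : ℕ) (p : ℕ → ℝ[X]) (i : ℕ) : Measurable (M.paste k p i) := by
  refine Finset.measurable_fun_sum _ fun n _ => ?_
  split_ifs
  · exact Measurable.indicator (by fun_prop) (M.measurableSet_cell n)
  · exact measurable_const

lemma h_le_nodeLen (hn : n < M.N) (hi : nodeMem k i n) : M.h n ≤ M.nodeLen k i := by
  classical
  calc M.h n = if nodeMem k i n then M.h n else 0 := (if_pos hi).symm
    _ ≤ M.nodeLen k i := by
        rw [nodeLen]
        convert Finset.single_le_sum (f := fun n => if nodeMem k i n then M.h n else 0)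
          (s := Finset.range M.N) (fun n' hn' => ?_) (Finset.mem_range.2 hn)
        split_ifs
        exacts [(M.h_pos (Finset.mem_range.1 hn')).le, le_rfl]

lemma measurable_psi (k i : ℕ) : Measurable (M.psi k i) := (M.measurable_paste _ _ _).const_mul _

lemma psi_eq_zero (hk : 1 ≤ k) (hn : n < M.N) (hi : nodeMem k i n)
    (ht : t ∉ Icc (M.left n) (M.right n)) : M.psi k i t = 0 := by
  rw [psi, M.paste_eq_zero_of_notMem_patch hk hn hi ht, mul_zero]

lemma abs_psi_le {c : ℝ}
    (hc : ∀ j ∈ Finset.range (k + 1), ∀ x ∈ Icc (0 : ℝ) 1, |(localDual k j).eval x| ≤ c)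
    (hn : n < M.N) (hi : nodeMem k i n) (t : ℝ) : |M.psi k i t| ≤ (M.h n)⁻¹ * c := by
  have hpos := M.h_pos hn
  have hlen := M.h_le_nodeLen hn hi
  rw [psi, abs_mul, abs_inv, abs_of_pos (hpos.trans_le hlen)]
  exact mul_le_mul (inv_anti₀ hpos hlen) (M.abs_paste_le hc i t) (abs_nonneg _)
    (inv_nonneg.2 hpos.le)

end Paste

/-! ### Moments of polynomials -/

variable {k i : ℕ}

/-- The polynomial `q`, given in the variable of time, in the local coordinate of `K n`. -/
noncomputable def pullback (n : ℕ) (q : ℝ[X]) : ℝ[X] :=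
  q.comp (Polynomial.C (M.node n) + Polynomial.C (M.h n) * Polynomial.X)

lemma eval_pullback (n : ℕ) (q : ℝ[X]) (x : ℝ) :
    (M.pullback n q).eval x = q.eval (M.node n + M.h n * x) := by
  simp [pullback]

lemma eval_loc_pullback (hn : n < M.N) (q : ℝ[X]) (t : ℝ) :
    (M.pullback n q).eval (M.loc n t) = q.eval t := by
  rw [eval_pullback, loc, mul_div_cancel₀ _ (M.h_pos hn).ne', add_sub_cancel]

lemma natDegree_pullback_le (n : ℕ) (q : ℝ[X]) : (M.pullback n q).natDegree ≤ q.natDegree := by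
  refine Polynomial.natDegree_comp_le.trans ((Nat.mul_le_mul_left _ ?_).trans_eq (mul_one _))
  compute_degree

lemma integral_eval_loc_mul (hn : n < M.N) (p q : ℝ[X]) :
    ∫ t in M.node n..M.node (n + 1), p.eval (M.loc n t) * q.eval t =
      M.h n * ip p (M.pullback n q) := by
  have hh := (M.h_pos hn).ne'
  simp only [← M.eval_loc_pullback hn q]
  simp only [loc, sub_div]
  rw [intervalIntegral.integral_comp_div_sub (fun x => p.eval x * (M.pullback n q).eval x) hh,
    smul_eq_mul, sub_self, ← sub_div, ← h, div_self hh, ip]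

open Classical in
lemma integral_paste_mul_eval (k : ℕ) (p : ℕ → ℝ[X]) (i : ℕ) (q : ℝ[X]) :
    ∫ t in Ioo 0 T, M.paste k p i t * q.eval t =
      ∑ n ∈ Finset.range M.N, if nodeMem k i n then
        M.h n * ip (p (i - n * k)) (M.pullback n q) else 0 := by
  have hmul (n : ℕ) (t : ℝ) :
      (M.cell n).indicator (fun t => (p (i - n * k)).eval (M.loc n t)) t * q.eval t =
        (M.cell n).indicator (fun t => (p (i - n * k)).eval (M.loc n t) * q.eval t) t :=
    (Set.indicator_mul_left (M.cell n) _ (q.eval ·)).symm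
  simp only [paste, Finset.sum_mul, ite_mul, zero_mul, hmul]
  rw [← integral_Icc_eq_integral_Ioo, integral_finsetSum _ fun n _ => ?_]
  · refine Finset.sum_congr rfl fun n hn => ?_
    rw [Finset.mem_range] at hn
    split_ifs
    · rw [setIntegral_indicator (M.measurableSet_cell n),
        inter_eq_right.2 ((M.cell_subset_K n).trans (M.K_subset_Icc hn)), M.setIntegral_cell hn,
        M.integral_eval_loc_mul hn]
    · exact integral_zero _ _
  · split_ifs
    · exact IntegrableOn.indicator
        (Continuous.integrableOn_Icc
          (by fun_prop : Continuous fun t => (p (i - n * k)).eval (M.loc n t) * q.eval t))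
        (M.measurableSet_cell n)
    · exact integrable_zero _ _ _

/-- For `n ≠ n'`, both sides are the value of `q` at the common point of `K n` and `K n'`. -/
lemma ip_localDual_pullback_eq {n' : ℕ} (hk : 1 ≤ k) (hi : nodeMem k i n) (hi' : nodeMem k i n')
    {q : ℝ[X]} (hq : q.natDegree ≤ k) :
    ip (localDual k (i - n * k)) (M.pullback n q) =
      ip (localDual k (i - n' * k)) (M.pullback n' q) := by
  wlog hlt : n < n' generalizing n n'
  · rcases (not_lt.1 hlt).eq_or_lt with rfl | h
    · rfl
    · exact (this hi' hi h).symm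
  obtain rfl : n' = n + 1 := (nodeMem.le_add_one hk hi' hi).antisymm hlt
  obtain rfl : i = (n + 1) * k := hi.2.antisymm hi'.1
  rw [Nat.sub_self, add_one_mul, Nat.add_sub_cancel_left,
    ip_localDual_self ((M.natDegree_pullback_le _ _).trans hq),
    ip_localDual_zero ((M.natDegree_pullback_le _ _).trans hq), eval_pullback, eval_pullback, h]
  ring_nf

lemma integral_psi_mul_eval (hk : 1 ≤ k) (hn : n < M.N) (hi : nodeMem k i n) {q : ℝ[X]}
    (hq : q.natDegree ≤ k) :
    ∫ t in Ioo 0 T, M.psi k i t * q.eval t = ip (localDual k (i - n * k)) (M.pullback n q) := by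
  classical
  have hsum : ∫ t in Ioo 0 T, M.paste k (localDual k) i t * q.eval t =
      M.nodeLen k i * ip (localDual k (i - n * k)) (M.pullback n q) := by
    rw [integral_paste_mul_eval, nodeLen, Finset.sum_mul]
    refine Finset.sum_congr rfl fun n' _ => ?_
    split_ifs with hi'
    · rw [M.ip_localDual_pullback_eq hk hi hi' hq]
    · rw [zero_mul]
  simp only [psi, mul_assoc]
  rw [integral_const_mul, hsum,
    inv_mul_cancel_left₀ ((M.h_pos hn).trans_le (M.h_le_nodeLen hn hi)).ne']

/-! ### Coefficients of the projection -/

section Coef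

variable {X : Type*} [NormedAddCommGroup X] [NormedSpace ℝ X] {f g : ℝ → X}

/-- The coefficient of `bern k i` in `proj k f`. -/
noncomputable def coef (k i : ℕ) (f : ℝ → X) : X := ∫ t in Ioo 0 T, M.psi k i t • f t

lemma integrableOn_psi_smul {S : Set ℝ} (hf : IntegrableOn f S) :
    IntegrableOn (fun t => M.psi k i t • f t) S := by
  obtain ⟨c, -, hc⟩ := exists_forall_abs_eval_le (Finset.range (k + 1)) (localDual k)
  refine hf.bdd_smul (|(M.nodeLen k i)⁻¹| * c) (M.measurable_psi k i).aestronglyMeasurable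
    (ae_of_all _ fun t => ?_)
  rw [psi, norm_mul]
  exact mul_le_mul_of_nonneg_left (M.abs_paste_le hc i t) (abs_nonneg _)

lemma coef_eq_setIntegral (hk : 1 ≤ k) (hn : n < M.N) (hi : nodeMem k i n) (f : ℝ → X) :
    M.coef k i f = ∫ t in Ioo (M.left n) (M.right n), M.psi k i t • f t := by
  rw [coef, ← integral_Icc_eq_integral_Ioo, ← integral_Icc_eq_integral_Ioo]
  refine setIntegral_eq_of_subset_of_forall_sdiff_eq_zero measurableSet_Icc
    (Icc_subset_Icc (M.zero_le_left hn) M.right_le) fun t ht => ?_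
  rw [M.psi_eq_zero hk hn hi ht.2, zero_smul]

lemma coef_congr (hk : 1 ≤ k) (hn : n < M.N) (hi : nodeMem k i n)
    (h : f =ᵐ[volume.restrict (Ioo (M.left n) (M.right n))] g) : M.coef k i f = M.coef k i g := by
  rw [M.coef_eq_setIntegral hk hn hi, M.coef_eq_setIntegral hk hn hi]
  exact integral_congr_ae (h.mono fun t ht => congrArg (M.psi k i t • ·) ht)

lemma coef_add (hk : 1 ≤ k) (hn : n < M.N) (hi : nodeMem k i n)
    (hf : IntegrableOn f (Ioo (M.left n) (M.right n)))
    (hg : IntegrableOn g (Ioo (M.left n) (M.right n))) :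
    M.coef k i (fun t => f t + g t) = M.coef k i f + M.coef k i g := by
  simp only [M.coef_eq_setIntegral hk hn hi, smul_add]
  exact integral_add (M.integrableOn_psi_smul hf) (M.integrableOn_psi_smul hg)

lemma coef_sum_pow_smul [CompleteSpace X] (hk : 1 ≤ k) (hn : n < M.N) (hi : nodeMem k i n) {s : ℕ}
    (hs : s ≤ k + 1) (c : ℕ → X) :
    M.coef k i (fun t => ∑ l ∈ Finset.range s, t ^ l • c l) =
      ∑ l ∈ Finset.range s,
        ip (localDual k (i - n * k)) (M.pullback n (Polynomial.X ^ l)) • c l := by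
  simp only [coef, Finset.smul_sum]
  rw [integral_finsetSum _ fun l _ => M.integrableOn_psi_smul ?_]
  · refine Finset.sum_congr rfl fun l hl => ?_
    have hdeg : (Polynomial.X ^ l : ℝ[X]).natDegree ≤ k :=
      (Polynomial.natDegree_X_pow_le l).trans (by have := Finset.mem_range.1 hl; omega)
    simp only [smul_smul]
    rw [integral_smul_const, ← M.integral_psi_mul_eval hk hn hi hdeg]
    simp only [Polynomial.eval_pow, Polynomial.eval_X]
  · exact ((by fun_prop : Continuous fun t : ℝ => t ^ l • c l).integrableOn_Icc).mono_set
      Ioo_subset_Icc_self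

lemma enorm_coef_le {b : ℝ}
    (hb : ∀ j ∈ Finset.range (k + 1), ∀ x ∈ Icc (0 : ℝ) 1, |(localDual k j).eval x| ≤ b)
    (hk : 1 ≤ k) (hn : n < M.N) (hi : nodeMem k i n) (f : ℝ → X) :
    ‖M.coef k i f‖ₑ ≤
      ENNReal.ofReal ((M.h n)⁻¹ * b) * ∫⁻ t in Ioo (M.left n) (M.right n), ‖f t‖ₑ := by
  rw [M.coef_eq_setIntegral hk hn hi, ← lintegral_const_mul' _ _ ENNReal.ofReal_ne_top]
  refine (enorm_integral_le_lintegral_enorm _).trans (lintegral_mono fun t => ?_)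
  rw [enorm_smul, Real.enorm_eq_ofReal_abs]
  gcongr
  exact M.abs_psi_le hb hn hi t

end Coef

/-! ### The projection on a single interval -/

section Projection

variable {M} {κ : ℝ} {m s : ℕ} {X : Type*} [NormedAddCommGroup X] [NormedSpace ℝ X]
  {f g : ℝ → X}

variable (M) in
/-- The `m`-th derivative of `proj k f` in the interior of `K n`, as a function on the whole line
that is polynomial. -/
noncomputable def projDeriv (k m n : ℕ) (f : ℝ → X) (t : ℝ) : X :=
  ∑ j ∈ Finset.range (k + 1),
    ((M.h n)⁻¹ ^ m * (Polynomial.derivative^[m] (bernsteinPolynomial ℝ k j)).eval (M.loc n t)) •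
      M.coef k (n * k + j) f

lemma nodeMem_add_of_mem_range {j : ℕ} (hj : j ∈ Finset.range (k + 1)) : nodeMem k (n * k + j) n :=
  nodeMem_iff_exists.2 ⟨j, Finset.mem_range_succ_iff.1 hj, rfl⟩

lemma proj_eq_projDeriv (hn : n < M.N) (f : ℝ → X) {t : ℝ} (ht : t ∈ M.openK n) :
    M.proj k f t = M.projDeriv k 0 n f t := by
  classical
  have hnodes : (Finset.range (M.N * k + 1)).filter (fun i => nodeMem k i n) =
      (Finset.range (k + 1)).image (n * k + ·) := by
    have hle : (n + 1) * k ≤ M.N * k := Nat.mul_le_mul_right k hn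
    ext i
    simp only [Finset.mem_filter, Finset.mem_image, Finset.mem_range, nodeMem_iff_exists]
    rw [add_one_mul] at hle
    exact ⟨fun ⟨_, j, _, h⟩ => ⟨j, by omega, h.symm⟩,
      fun ⟨j, _, h⟩ => ⟨by omega, j, by omega, h.symm⟩⟩
  simp only [proj, bern, M.paste_of_mem_cell hn (M.openK_subset_cell n ht), ite_smul, zero_smul]
  rw [← Finset.sum_filter, hnodes, Finset.sum_image fun i _ j _ h => Nat.add_left_cancel h]
  simp [projDeriv, coef]

lemma hasDerivAt_projDeriv (k m n : ℕ) (f : ℝ → X) (t : ℝ) :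
    HasDerivAt (M.projDeriv k m n f) (M.projDeriv k (m + 1) n f t) t := by
  refine HasDerivAt.fun_sum fun j _ => HasDerivAt.smul_const ?_ _
  have hloc : HasDerivAt (M.loc n) (M.h n)⁻¹ t := by
    rw [← one_div]
    exact ((hasDerivAt_id' t).sub_const (M.node n)).div_const (M.h n)
  have hpoly := (((Polynomial.derivative^[m] (bernsteinPolynomial ℝ k j)).hasDerivAt _).comp t
    hloc).const_mul ((M.h n)⁻¹ ^ m)
  rwa [← Function.iterate_succ_apply' (f := Polynomial.derivative), mul_comm (Polynomial.eval _ _),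
    ← mul_assoc, ← pow_succ] at hpoly

lemma projDeriv_congr (hk : 1 ≤ k) (hn : n < M.N)
    (h : f =ᵐ[volume.restrict (Ioo (M.left n) (M.right n))] g) :
    M.projDeriv k m n f = M.projDeriv k m n g :=
  funext fun _ => Finset.sum_congr rfl fun _ hj => by
    rw [M.coef_congr hk hn (nodeMem_add_of_mem_range hj) h]

lemma projDeriv_add (hk : 1 ≤ k) (hn : n < M.N)
    (hf : IntegrableOn f (Ioo (M.left n) (M.right n)))
    (hg : IntegrableOn g (Ioo (M.left n) (M.right n))) (t : ℝ) :
    M.projDeriv k m n (fun t => f t + g t) t =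
      M.projDeriv k m n f t + M.projDeriv k m n g t := by
  rw [projDeriv, projDeriv, projDeriv, ← Finset.sum_add_distrib]
  exact Finset.sum_congr rfl fun j hj => by
    rw [M.coef_add hk hn (nodeMem_add_of_mem_range hj) hf hg, smul_add]

lemma projDeriv_sum_pow_smul [CompleteSpace X] (hk : 1 ≤ k) (hn : n < M.N) (hs : s ≤ k + 1)
    (c : ℕ → X) (t : ℝ) :
    M.projDeriv k 0 n (fun t => ∑ l ∈ Finset.range s, t ^ l • c l) t =
      ∑ l ∈ Finset.range s, t ^ l • c l := by
  have hpow (l : ℕ) (hl : l ∈ Finset.range s) :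
      ∑ j ∈ Finset.range (k + 1), (bernsteinPolynomial ℝ k j).eval (M.loc n t) *
        ip (localDual k j) (M.pullback n (Polynomial.X ^ l)) = t ^ l := by
    have hdeg : (M.pullback n (Polynomial.X ^ l)).natDegree ≤ k :=
      (M.natDegree_pullback_le n _).trans ((Polynomial.natDegree_X_pow_le l).trans
        (by have := Finset.mem_range.1 hl; omega))
    have h := congrArg (Polynomial.eval (M.loc n t))
      (sum_ip_localDual_smul_bernsteinPolynomial hdeg)
    simpa only [Polynomial.eval_finsetSum, Polynomial.eval_smul, smul_eq_mul, mul_comm,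
      M.eval_loc_pullback hn, Polynomial.eval_pow, Polynomial.eval_X] using h
  calc M.projDeriv k 0 n (fun t => ∑ l ∈ Finset.range s, t ^ l • c l) t
      = ∑ j ∈ Finset.range (k + 1), (bernsteinPolynomial ℝ k j).eval (M.loc n t) •
          ∑ l ∈ Finset.range s, ip (localDual k j) (M.pullback n (Polynomial.X ^ l)) • c l :=
        Finset.sum_congr rfl fun j hj => by
          rw [M.coef_sum_pow_smul hk hn (nodeMem_add_of_mem_range hj) hs, pow_zero, one_mul,
            Function.iterate_zero_apply, Nat.add_sub_cancel_left]
    _ = ∑ l ∈ Finset.range s, (∑ j ∈ Finset.range (k + 1),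
          (bernsteinPolynomial ℝ k j).eval (M.loc n t) *
            ip (localDual k j) (M.pullback n (Polynomial.X ^ l))) • c l := by
        simp only [Finset.smul_sum, Finset.sum_smul, mul_smul]
        exact Finset.sum_comm
    _ = ∑ l ∈ Finset.range s, t ^ l • c l :=
        Finset.sum_congr rfl fun l hl => by rw [hpow l hl]

lemma enorm_projDeriv_le {B b : ℝ}
    (hB : ∀ j ∈ Finset.range (k + 1), ∀ x ∈ Icc (0 : ℝ) 1,
      |(Polynomial.derivative^[m] (bernsteinPolynomial ℝ k j)).eval x| ≤ B)
    (hb : ∀ j ∈ Finset.range (k + 1), ∀ x ∈ Icc (0 : ℝ) 1, |(localDual k j).eval x| ≤ b)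
    (hk : 1 ≤ k) (hn : n < M.N) (f : ℝ → X) {t : ℝ} (ht : t ∈ M.openK n) :
    ‖M.projDeriv k m n f t‖ₑ ≤ ENNReal.ofReal ((k + 1) * B * b * (M.h n)⁻¹ ^ (m + 1)) *
      ∫⁻ t in Ioo (M.left n) (M.right n), ‖f t‖ₑ := by
  have hh : 0 ≤ (M.h n)⁻¹ := inv_nonneg.2 (M.h_pos hn).le
  have hterm (j : ℕ) (hj : j ∈ Finset.range (k + 1)) :
      ‖((M.h n)⁻¹ ^ m * (Polynomial.derivative^[m] (bernsteinPolynomial ℝ k j)).eval (M.loc n t)) •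
        M.coef k (n * k + j) f‖ₑ ≤ ENNReal.ofReal ((M.h n)⁻¹ ^ m * B) *
          (ENNReal.ofReal ((M.h n)⁻¹ * b) * ∫⁻ t in Ioo (M.left n) (M.right n), ‖f t‖ₑ) := by
    rw [enorm_smul, Real.enorm_eq_ofReal_abs, abs_mul, abs_of_nonneg (pow_nonneg hh m)]
    gcongr
    · exact hB j hj _ (M.loc_mem hn (Ioo_subset_Icc_self ht))
    · exact M.enorm_coef_le hb hk hn (nodeMem_add_of_mem_range hj) f
  refine (enorm_sum_le _ _).trans ((Finset.sum_le_card_nsmul _ _ _ hterm).trans_eq ?_)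
  have hB0 : 0 ≤ B := (abs_nonneg _).trans (hB 0 (by simp) 0 (by simp))
  rw [Finset.card_range, nsmul_eq_mul, ← ENNReal.ofReal_natCast, ← mul_assoc, ← mul_assoc,
    ← ENNReal.ofReal_mul (by positivity), ← ENNReal.ofReal_mul (by positivity)]
  congr 2
  push_cast
  ring

lemma eLpNorm_projDeriv_le {B b : ℝ} {p : ℝ≥0∞} (hp : 1 ≤ p)
    (hB : ∀ j ∈ Finset.range (k + 1), ∀ x ∈ Icc (0 : ℝ) 1,
      |(Polynomial.derivative^[m] (bernsteinPolynomial ℝ k j)).eval x| ≤ B)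
    (hb : ∀ j ∈ Finset.range (k + 1), ∀ x ∈ Icc (0 : ℝ) 1, |(localDual k j).eval x| ≤ b)
    (hk : 1 ≤ k) (hn : n < M.N)
    (hf : AEStronglyMeasurable f (volume.restrict (Ioo (M.left n) (M.right n)))) :
    eLpNorm (M.projDeriv k m n f) p (volume.restrict (M.openK n)) ≤
      ENNReal.ofReal ((k + 1) * B * b * (M.h n)⁻¹ ^ (m + 1)) *
        ENNReal.ofReal (M.right n - M.left n) *
          eLpNorm f p (volume.restrict (Ioo (M.left n) (M.right n))) := by
  rw [← Real.volume_Ioo, ← Measure.restrict_apply_univ]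
  refine eLpNorm_le_of_enorm_le_lintegral hp ?_ hf
    ((ae_restrict_mem measurableSet_Ioo).mono fun t ht => enorm_projDeriv_le hB hb hk hn f ht)
  simpa only [Measure.restrict_apply_univ] using measure_mono (M.openK_subset hn)

/-! ### The remainder -/

lemma isWeakDeriv_sub_proj [CompleteSpace X] (hk : 1 ≤ k) (hn : n < M.N) (hms : m ≤ s)
    (hs : s ≤ k + 1) (h : IsWeakDeriv s (Ioo (M.left n) (M.right n)) f g)
    (hg : IntegrableOn g (Ioo (M.left n) (M.right n))) :
    IsWeakDeriv m (M.openK n) (fun t => f t - M.proj k f t)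
      (iterPrim (M.left n) g (s - m) - M.projDeriv k m n (iterPrim (M.left n) g s)) := by
  obtain ⟨c, hc⟩ := h.exists_taylor (M.left_lt_right hn) hg
  refine (((isWeakDeriv_iterPrim hg hms).mono (M.openK_subset hn)).sub
    (isWeakDeriv_of_hasDerivAt
      (fun j => hasDerivAt_projDeriv k j n (iterPrim (M.left n) g s)) m _)).congr ?_
  filter_upwards [ae_restrict_of_ae_restrict_of_subset (M.openK_subset hn) hc,
    ae_restrict_mem measurableSet_Ioo] with t hct ht
  have hP : IntegrableOn (fun t => ∑ l ∈ Finset.range s, t ^ l • c l)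
      (Ioo (M.left n) (M.right n)) :=
    ((by fun_prop : Continuous fun t : ℝ => ∑ l ∈ Finset.range s, t ^ l • c l).integrableOn_Icc
      ).mono_set Ioo_subset_Icc_self
  rw [proj_eq_projDeriv hn f ht, projDeriv_congr hk hn hc,
    projDeriv_add hk hn hP (integrableOn_iterPrim hg s), projDeriv_sum_pow_smul hk hn hs, hct,
    add_sub_add_left_eq_sub, Pi.sub_apply]

lemma pow_add_mul_inv_pow_mul_pow_le {δ D h : ℝ} (hδ : 0 ≤ δ) (hD : 0 ≤ D) (hh : 0 < h)
    (hδh : δ ≤ κ * h) (hκ : 1 ≤ κ) (hms : m ≤ s) (hs : s ≤ k + 1) :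
    δ ^ (s - m) + D * h⁻¹ ^ (m + 1) * δ ^ (s + 1) ≤ (1 + D) * κ ^ (k + 2) * h ^ (s - m) := by
  obtain ⟨r, rfl⟩ := Nat.exists_eq_add_of_le hms
  rw [Nat.add_sub_cancel_left]
  have hcancel : h⁻¹ ^ (m + 1) * h ^ (m + r + 1) = h ^ r := by
    rw [Nat.add_right_comm, pow_add h, ← mul_assoc, ← mul_pow, inv_mul_cancel₀ hh.ne', one_pow,
      one_mul]
  have hκr : κ ^ r ≤ κ ^ (k + 2) := pow_le_pow_right₀ hκ (by omega)
  have hκs : κ ^ (m + r + 1) ≤ κ ^ (k + 2) := pow_le_pow_right₀ hκ (by omega)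
  calc δ ^ r + D * h⁻¹ ^ (m + 1) * δ ^ (m + r + 1)
      ≤ (κ * h) ^ r + D * h⁻¹ ^ (m + 1) * (κ * h) ^ (m + r + 1) := by gcongr
    _ = κ ^ r * h ^ r + D * κ ^ (m + r + 1) * h ^ r := by
        rw [mul_pow, mul_pow, ← hcancel]
        ring
    _ ≤ κ ^ (k + 2) * h ^ r + D * κ ^ (k + 2) * h ^ r := by gcongr
    _ = (1 + D) * κ ^ (k + 2) * h ^ r := by ring

lemma eLpNorm_iterPrim_sub_projDeriv_le {B b : ℝ} {p : ℝ≥0∞} (hp : 1 ≤ p)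
    (hB : ∀ j ∈ Finset.range (k + 1), ∀ x ∈ Icc (0 : ℝ) 1,
      |(Polynomial.derivative^[m] (bernsteinPolynomial ℝ k j)).eval x| ≤ B)
    (hb : ∀ j ∈ Finset.range (k + 1), ∀ x ∈ Icc (0 : ℝ) 1, |(localDual k j).eval x| ≤ b)
    (hk : 1 ≤ k) (hM : M.ShapeRegular κ) (hn : n < M.N) (hms : m ≤ s) (hs : s ≤ k + 1)
    (hg : IntegrableOn g (Ioo (M.left n) (M.right n))) :
    eLpNorm (iterPrim (M.left n) g (s - m) - M.projDeriv k m n (iterPrim (M.left n) g s)) p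
        (volume.restrict (M.openK n)) ≤
      ENNReal.ofReal ((1 + (k + 1) * B * b) * κ ^ (k + 2) * M.h n ^ (s - m)) *
        eLpNorm g p (volume.restrict (Ioo (M.left n) (M.right n))) := by
  set G := eLpNorm g p (volume.restrict (Ioo (M.left n) (M.right n)))
  set δ := M.right n - M.left n
  set D := (k + 1) * B * b
  have hR : IntegrableOn (iterPrim (M.left n) g (s - m)) (M.openK n) :=
    (integrableOn_iterPrim hg _).mono_set (M.openK_subset hn)
  have hproj : Continuous (M.projDeriv k m n (iterPrim (M.left n) g s)) :=
    continuous_iff_continuousAt.2 fun t => (hasDerivAt_projDeriv k m n _ t).continuousAt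
  have hRnorm : eLpNorm (iterPrim (M.left n) g (s - m)) p (volume.restrict (M.openK n)) ≤
      ENNReal.ofReal δ ^ (s - m) * G :=
    (eLpNorm_mono_measure _ (Measure.restrict_mono (M.openK_subset hn) le_rfl)).trans
      (eLpNorm_iterPrim_le hp hg _)
  have hprojnorm : eLpNorm (M.projDeriv k m n (iterPrim (M.left n) g s)) p
      (volume.restrict (M.openK n)) ≤ ENNReal.ofReal (D * (M.h n)⁻¹ ^ (m + 1)) *
        ENNReal.ofReal δ * (ENNReal.ofReal δ ^ s * G) :=
    (eLpNorm_projDeriv_le hp hB hb hk hn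
      (integrableOn_iterPrim hg s).aestronglyMeasurable).trans
        (mul_le_mul_right (eLpNorm_iterPrim_le hp hg s) _)
  have hδ0 : 0 ≤ δ := (M.h_pos hn).le.trans (M.h_le hn)
  have hD0 : 0 ≤ D := by
    have hB0 : 0 ≤ B := (abs_nonneg _).trans (hB 0 (by simp) 0 (by simp))
    have hb0 : 0 ≤ b := (abs_nonneg _).trans (hb 0 (by simp) 0 (by simp))
    positivity
  have hh := M.h_pos hn
  refine (eLpNorm_sub_le hR.aestronglyMeasurable hproj.aestronglyMeasurable hp).trans
    ((add_le_add hRnorm hprojnorm).trans ?_)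
  rw [← mul_assoc, ← add_mul, mul_assoc (ENNReal.ofReal _), ← pow_succ', ← ENNReal.ofReal_pow hδ0,
    ← ENNReal.ofReal_pow hδ0, ← ENNReal.ofReal_mul (by positivity),
    ← ENNReal.ofReal_add (by positivity) (by positivity)]
  gcongr
  exact pow_add_mul_inv_pow_mul_pow_le hδ0 hD0 hh (hM.right_sub_left_le hn) (hM.one_le hn) hms hs

end Projection

end TimeMesh

lemma derivNorm_le_mul_derivNorm {X Y : Type*} [NormedAddCommGroup X] [NormedSpace ℝ X]
    [NormedAddCommGroup Y] [NormedSpace ℝ Y] {m s : ℕ} {I J : Set ℝ} {f : ℝ → X} {f' : ℝ → Y}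
    {c : ℝ≥0∞} (hc0 : c ≠ 0) (hc : c ≠ ∞)
    (h : ∀ g', IsWeakDeriv s (interior J) f' g' → eLpNorm g' 2 (volume.restrict J) ≠ ∞ →
      ∃ g, IsWeakDeriv m (interior I) f g ∧
        eLpNorm g 2 (volume.restrict I) ≤ c * eLpNorm g' 2 (volume.restrict J)) :
    derivNorm m I f ≤ c * derivNorm s J f' := by
  simp only [derivNorm, ENNReal.mul_iInf_of_ne hc0 hc]
  refine le_iInf₂ fun g' hg' => ?_
  rcases eq_or_ne (eLpNorm g' 2 (volume.restrict J)) ∞ with htop | htop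
  · rw [htop, ENNReal.mul_top hc0]
    exact le_top
  · obtain ⟨g, hg, hle⟩ := h g' hg' htop
    exact (iInf₂_le g hg).trans hle

theorem TimeMesh.exists_derivNorm_sub_proj_le (k : ℕ) (hk : 1 ≤ k) (κ : ℝ) :
    ∃ C : ℝ≥0, ∀ (T : ℝ) (M : TimeMesh T) (_ : M.ShapeRegular κ) (X : Type*)
      [NormedAddCommGroup X] [NormedSpace ℝ X] [CompleteSpace X] (f : ℝ → X) (m s : ℕ)
      (_ : m ≤ s) (_ : s ≤ k + 1) (n : ℕ) (_ : n < M.N),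
      derivNorm m (M.K n) (fun t => f t - M.proj k f t) ≤
        C * ENNReal.ofReal (M.h n ^ (s - m)) * derivNorm s (M.patch n) f := by
  obtain ⟨B, hB0, hB⟩ := exists_forall_abs_eval_le (Finset.range (k + 1) ×ˢ Finset.range (k + 2))
    fun jm => Polynomial.derivative^[jm.2] (bernsteinPolynomial ℝ k jm.1)
  obtain ⟨b, hb0, hb⟩ := exists_forall_abs_eval_le (Finset.range (k + 1)) (localDual k)
  refine ⟨((1 + (k + 1) * B * b) * κ ^ (k + 2)).toNNReal,
    fun T M hM X _ _ _ f m s hms hs n hn => ?_⟩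
  have hpos := M.h_pos hn
  have hκ : 0 < κ := one_pos.trans_le (hM.one_le hn)
  have hBm (j : ℕ) (hj : j ∈ Finset.range (k + 1)) := hB (j, m)
    (Finset.mem_product.2 ⟨hj, Finset.mem_range.2 (by omega)⟩)
  have hC : 0 < (1 + (k + 1) * B * b) * κ ^ (k + 2) := by positivity
  rw [← ENNReal.ofReal, ← ENNReal.ofReal_mul hC.le]
  refine derivNorm_le_mul_derivNorm (ENNReal.ofReal_pos.2 (by positivity)).ne'
    ENNReal.ofReal_ne_top fun g hg hgtop => ?_
  rw [M.patch_eq hn, interior_Icc] at hg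
  rw [M.patch_eq hn, ← restrict_Ioo_eq_restrict_Icc] at hgtop ⊢
  rw [K, interior_Icc, ← restrict_Ioo_eq_restrict_Icc]
  have hgint : IntegrableOn g (Ioo (M.left n) (M.right n)) :=
    MemLp.integrable one_le_two ⟨hg.2.1.aestronglyMeasurable, hgtop.lt_top⟩
  exact ⟨_, isWeakDeriv_sub_proj hk hn hms hs hg hgint,
    eLpNorm_iterPrim_sub_projDeriv_le one_le_two hBm hb hk hM hn hms hs hgint⟩

lemma TimeMesh.map_proj {T : ℝ} (M : TimeMesh T) (k : ℕ) {X Y : Type*} [NormedAddCommGroup X]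
    [NormedSpace ℝ X] [CompleteSpace X] [NormedAddCommGroup Y] [NormedSpace ℝ Y] [CompleteSpace Y]
    (L : X →L[ℝ] Y) {v : ℝ → X} (hv : IntegrableOn v (Ioo 0 T)) (t : ℝ) :
    L (M.proj k v t) = M.proj k (fun t => L (v t)) t := by
  simp only [proj, map_sum, map_smul]
  refine Finset.sum_congr rfl fun i _ => ?_
  rw [← L.integral_comp_comm (M.integrableOn_psi_smul hv)]
  simp only [map_smul]

/-! ### Continuity of the embeddings in space -/

section Space

variable {d : ℕ} {ω Ω : Set (Euc d)}

lemma coeFn_restrictL2 (h : ω ⊆ Ω) (u : L2 Ω) : restrictL2 h u =ᵐ[volume.restrict ω] u :=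
  MemLp.coeFn_toLp _

/-- The restriction `restrictL2` as a continuous linear map. -/
noncomputable def restrictL2CLM (h : ω ⊆ Ω) : L2 Ω →L[ℝ] L2 ω :=
  LinearMap.mkContinuous
    { toFun := restrictL2 h
      map_add' := fun u w => by
        apply Lp.ext
        filter_upwards [coeFn_restrictL2 h (u + w), coeFn_restrictL2 h u, coeFn_restrictL2 h w,
          Lp.coeFn_add (restrictL2 h u) (restrictL2 h w),
          ae_restrict_of_ae_restrict_of_subset h (Lp.coeFn_add u w)] with x h1 h2 h3 h4 h5
        rw [h1, h4, h5, Pi.add_apply, Pi.add_apply, h2, h3]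
      map_smul' := fun c u => by
        apply Lp.ext
        filter_upwards [coeFn_restrictL2 h (c • u), coeFn_restrictL2 h u,
          Lp.coeFn_smul c (restrictL2 h u),
          ae_restrict_of_ae_restrict_of_subset h (Lp.coeFn_smul c u)] with x h1 h2 h3 h4
        rw [RingHom.id_apply, h1, h3, h4, Pi.smul_apply, Pi.smul_apply, h2] }
    1 fun u => by
      change ‖restrictL2 h u‖ ≤ 1 * ‖u‖
      rw [one_mul, restrictL2, Lp.norm_toLp, Lp.norm_def]
      exact ENNReal.toReal_mono (Lp.eLpNorm_ne_top u)
        (eLpNorm_mono_measure _ (Measure.restrict_mono h le_rfl))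

variable [NeZero d]

/-- The embedding `toWneg` as a continuous linear map. -/
noncomputable def toWnegCLM (hω : Bornology.IsBounded ω) (h : ω ⊆ Ω) : L2 Ω →L[ℝ] Wneg ω :=
  LinearMap.mkContinuous
    { toFun := toWneg hω h
      map_add' := fun u w => by
        ext z
        exact (congrArg (inner ℝ · _) (map_add (restrictL2CLM h) u w)).trans (inner_add_left _ _ _)
      map_smul' := fun c u => by
        ext z
        exact (congrArg (inner ℝ · _) (map_smul (restrictL2CLM h) c u)).trans
          (real_inner_smul_left _ _ _) }
    (‖W01.toL2CLM hω‖ * ‖restrictL2CLM h‖) fun u => by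
      change ‖(innerSL ℝ (restrictL2CLM h u)).comp (W01.toL2CLM hω)‖ ≤ _
      refine (ContinuousLinearMap.opNorm_comp_le _ _).trans ?_
      rw [innerSL_apply_norm, mul_comm, mul_assoc]
      gcongr
      exact (restrictL2CLM h).le_opNorm u

instance : CompleteSpace (Wneg ω) := inferInstanceAs (CompleteSpace (W01 ω →L[ℝ] ℝ))

lemma integrableOn_of_mem_V {T : ℝ} {hΩ : Bornology.IsBounded Ω} {v : ℝ → L2 Ω}
    (hv : v ∈ V T hΩ) : IntegrableOn v (Ioo 0 T) := by
  obtain ⟨⟨w, hw, hvw⟩, -⟩ := hv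
  have hmeas : AEStronglyMeasurable (fun t => W01.toL2CLM hΩ (w t)) (volume.restrict (Ioo 0 T)) :=
    (W01.toL2CLM hΩ).continuous.comp_aestronglyMeasurable hw.1
  have hmem : MemLp (fun t => W01.toL2CLM hΩ (w t)) 2 (volume.restrict (Ioo 0 T)) :=
    hw.of_le_mul' (c := ‖W01.toL2CLM hΩ‖₊) hmeas (Filter.Eventually.of_forall fun t =>
      ENNReal.coe_le_coe.2 ((W01.toL2CLM hΩ).le_opNNNorm (w t)))
  have heq : (fun t => W01.toL2CLM hΩ (w t)) =ᵐ[volume.restrict (Ioo 0 T)] v := by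
    filter_upwards [hvw] with t ht
    rw [ht]
    rfl
  exact (hmem.integrable one_le_two).congr heq

end Space

end SpaceTime

theorem theorem4p2_general (k : ℕ) (hk : 1 ≤ k) (κ : ℝ) :
    ∃ C : ℝ≥0, ∀ (T : ℝ) (M : SpaceTime.TimeMesh T) (_ : M.ShapeRegular κ)
      (X Y : Type*) [NormedAddCommGroup X] [NormedSpace ℝ X] [CompleteSpace X]
      [NormedAddCommGroup Y] [NormedSpace ℝ Y] [CompleteSpace Y] (L : X →L[ℝ] Y) (v : ℝ → X)
      (_ : IntegrableOn v (Ioo 0 T)) (m s : ℕ) (_ : m ≤ s) (_ : s ≤ k + 1) (n : ℕ) (_ : n < M.N),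
      SpaceTime.derivNorm m (M.K n) (fun t => L (v t - M.proj k v t)) ≤
        C * ENNReal.ofReal (M.h n ^ (s - m)) *
          SpaceTime.derivNorm s (M.patch n) (fun t => L (v t)) := by
  obtain ⟨C, hC⟩ := SpaceTime.TimeMesh.exists_derivNorm_sub_proj_le k hk κ
  refine ⟨C, fun T M hM X Y _ _ _ _ _ _ L v hv m s hms hs n hn => ?_⟩
  simp only [map_sub, M.map_proj k L hv]
  exact hC T M hM Y (fun t => L (v t)) m s hms hs n hn

theorem theorem4p2 (k : ℕ) (hk : 1 ≤ k) (κ : ℝ) :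
    ∃ C : ℝ≥0, ∀ (T : ℝ) (_ : 0 < T) (M : SpaceTime.TimeMesh T) (_ : M.ShapeRegular κ)
      (d : ℕ) [NeZero d] (Ω : Set (SpaceTime.Euc d)) (_ : IsOpen Ω)
      (hΩ : Bornology.IsBounded Ω) (v : ℝ → SpaceTime.L2 Ω) (_ : v ∈ SpaceTime.V T hΩ)
      (m s : ℕ) (_ : m ≤ s) (_ : s ≤ k + 1) (n : ℕ) (_ : n < M.N),
      (∀ (ω : Set (SpaceTime.Euc d)) (_ : IsOpen ω) (hω : ω ⊆ Ω),
        SpaceTime.derivNorm m (M.K n)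
            (fun t => SpaceTime.toWneg (hΩ.subset hω) hω (v t - M.proj k v t)) ≤
          C * ENNReal.ofReal (M.h n ^ (s - m)) *
            SpaceTime.derivNorm s (M.patch n)
              (fun t => SpaceTime.toWneg (hΩ.subset hω) hω (v t))) ∧
      (∀ (S : Geometry.SimplicialComplex ℝ (SpaceTime.Euc d)) (_ : SpaceTime.IsTriangulation S Ω),
        ∀ K ∈ SpaceTime.simplices S,
        SpaceTime.derivNorm m (M.K n)
            (fun t => SpaceTime.restrictL2 (S := K ∩ Ω) inter_subset_right
              (v t - M.proj k v t)) ≤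
          C * ENNReal.ofReal (M.h n ^ (s - m)) *
            SpaceTime.derivNorm s (M.patch n)
              (fun t => SpaceTime.restrictL2 (S := K ∩ Ω) inter_subset_right (v t))) := by
  obtain ⟨C, hC⟩ := theorem4p2_general k hk κ
  exact ⟨C, fun T _ M hM d _ Ω _ hΩ v hv m s hms hs n hn =>
    ⟨fun ω _ hω => hC T M hM _ _ (SpaceTime.toWnegCLM (hΩ.subset hω) hω) v
        (SpaceTime.integrableOn_of_mem_V hv) m s hms hs n hn,
      fun S _ K _ => hC T M hM _ _ (SpaceTime.restrictL2CLM (ω := K ∩ Ω) inter_subset_right) v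
        (SpaceTime.integrableOn_of_mem_V hv) m s hms hs n hn⟩⟩
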